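/- All logarithms are to base $2$; $h(p)=-p\log p-(1-p)\log(1-p)$. Let $|x\rangle_+$ ($x\in\{0,1\}$) be the computational basis of a qubit and $|x\rangle_\times=(|0\rangle+(-1)^x|1\rangle)/\sqrt2$. **Protocol.** Parameters: $n,\ell\in\mathbb N$; $\varepsilon>0$; an erasure rate $p_{\rm erase}\in[0,1)$ with $\varepsilon<1-p_{\rm erase}$; a bit-error rate $p_{\rm error}\in[0,1/2)$; a two-universal family $\mathcal F$ of functions $\{0,1\}^n\to\{0,1\}^\ell$; and, for every length $m$, the syndrome map ${\rm syn}$ of a binary linear code of length $m$, where for every $m\in J:=\left[(1-p_{\rm erase}-\varepsilon)\frac n2,(1-p_{\rm erase}+\varepsilon)\frac n2\right]$ the syndrome has at most $h(p_{\rm error})(1-p_{\rm erase}+\varepsilon)\frac n2$ bits. Alice picks $X\in\{0,1\}^n$ and $\Theta\in\{+,\times\}^n$ uniformly at random and sends the qubits $|X_i\rangle_{\Theta_i}$ to Bob. Bob reports a set $R\subseteq\{1,\dots,n\}$ of received qubits. Let $I_b=\{i\in R:\Theta_i=b\}$ for $b\in\{+,\times\}$. Alice aborts unless $|I_+|,|I_\times|\in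 J$. Otherwise she picks $F_+,F_\times\in\mathcal F$ uniformly and independently, outputs $S_b=F_b(X_{|I_b})$ (the string $X_{|I_b}$ being padded with zeros to length $n$), and sends $I_+,I_\times,F_+,F_\times,{\rm syn}(X_{|I_+}),{\rm syn}(X_{|I_\times})$ to Bob. **Individual-storage attacks.** Let $\mathcal N_1,\dots,\mathcal N_n$ be quantum operations (the storage noise, in finite dimensions). A dishonest Bob receives the qubits without noise, applies to the $i$th one an arbitrary partial measurement $\{M_{k}\}$, $\sum_kM_k^\dagger M_k={\sf id}$, with outcome $K_i$, and stores the post-measurement state, which $\mathcal N_i$ turns into the state of a register $E_i$. The set $R$ that he reports may depend on all outcomes $K=(K_1,\dots,K_n)$. His final state $\rho_B$ consists of $K$, $E_1,\dots,E_n$ and Alice's message. A real number $t$ is an uncertainty lower bound for $\mathcal N_1,\dots,\mathcal N_n$ if $H(X_i|\Theta_iK_iE_i)\ge t$ (conditional von Neumann entropy) for every $i$ and every partial measurement in round $i$. **Theorem.** Let $t$ be an uncertainty lower bound for $\mathcal N_1,\dots,\mathcal N_n$, let $\delta=8\sqrt{\dfrac{\log(2/\varepsilon^4)}{(1-p_{\rm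 erase}-\varepsilon)n}}$, and suppose that $n\ge\frac85\log\frac2{\varepsilon^4}$ and $$\ell\le(t-\delta-h(p_{\rm error}))(1-p_{\rm erase})\frac n4-\varepsilon\frac n2+\frac12-\log\frac1\varepsilon .$$ Then the protocol is secure against a dishonest receiver with error at most $2\varepsilon$: for every individual-storage attack there is a random variable $D\in\{+,\times\}$ (an extension of the joint final state of $S_+,S_\times$ and Bob by a classical register $D$) such that, with $\bar D$ the other basis, $d(S_{\bar D}\,|\,S_DD\rho_B)\le2\varepsilon$. Here $d(Y|E)=\frac12\left\|\frac{{\sf id}_Y}{|\mathcal Y|}\otimes\rho_E-\rho_{YE}\right\|_1$, evaluated on the (subnormalised) part of the final state in which Alice does not abort. -/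

import Mathlib

open scoped Matrix BigOperators ComplexOrder

noncomputable section

/-! ## Operators on finite-dimensional Hilbert spaces -/

/-- The trace norm `‖A‖₁ = Tr √(A† A)`. -/
def traceNorm {d : Type*} [Fintype d] [DecidableEq d] (A : Matrix d d ℂ) : ℝ :=
  (Matrix.trace (cfc Real.sqrt (Aᴴ * A))).re

/-- The von Neumann entropy `H(ρ) = - Tr (ρ log₂ ρ)`. -/
def vonNeumannEntropy {d : Type*} [Fintype d] [DecidableEq d] (ρ : Matrix d d ℂ) : ℝ :=
  (Matrix.trace (cfc (fun r : ℝ => -(r * Real.logb 2 r)) ρ)).re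

/-- The tensor product `⨂ i, M i` of finitely many operators. -/
def piTensor {n : ℕ} {d : Fin n → ℕ} (M : ∀ i, Matrix (Fin (d i)) (Fin (d i)) ℂ) :
    Matrix (∀ i, Fin (d i)) (∀ i, Fin (d i)) ℂ :=
  Matrix.of fun e e' => ∏ i, M i (e i) (e' i)

/-! ## States with classical registers

A state with a classical register `X` and a further system `E` is given by the family of
its unnormalised blocks `ρ x = P_X(x) ρ_E^x`; the operator itself is
`∑ x, |x⟩⟨x| ⊗ ρ x`, that is, `Matrix.blockDiagonal ρ`. -/

/-- Conditional von Neumann entropy `H(X | C E) = H(ρ_XCE) - H(ρ_CE)` of a state with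
classical registers `X`, `C` and a quantum register `E`. -/
def condEntropy {X C d : Type*} [Fintype X] [DecidableEq X] [Fintype C] [DecidableEq C]
    [Fintype d] [DecidableEq d] (ρ : X → C → Matrix d d ℂ) : ℝ :=
  vonNeumannEntropy (Matrix.blockDiagonal fun xc : X × C => ρ xc.1 xc.2) -
    vonNeumannEntropy (Matrix.blockDiagonal fun c : C => ∑ x, ρ x c)

/-- Non-uniformity `d(X | E) = ½ ‖ id_X / |X| ⊗ ρ_E - ∑ x, |x⟩⟨x| ⊗ ρ x ‖₁`,
where `ρ_E = ∑ x, ρ x`. -/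
def nonUniformity {X d : Type*} [Fintype X] [DecidableEq X] [Fintype d] [DecidableEq d]
    (ρ : X → Matrix d d ℂ) : ℝ :=
  1 / 2 * traceNorm
    (Matrix.blockDiagonal fun x : X => ((Fintype.card X : ℂ)⁻¹ • ∑ y, ρ y) - ρ x)

/-- The binary entropy function, with logarithms to base two. -/
def binaryEntropy (p : ℝ) : ℝ :=
  -(p * Real.logb 2 p) - (1 - p) * Real.logb 2 (1 - p)

/-! ## Quantum operations and partial measurements -/

/-- A quantum operation (completely positive trace-preserving map) from a `d`-dimensional
to a `d'`-dimensional system, in operator-sum form. -/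
structure QuantumOperation (d d' : ℕ) where
  rank : ℕ
  kraus : Fin rank → Matrix (Fin d') (Fin d) ℂ
  complete : ∑ a, (kraus a)ᴴ * kraus a = 1

/-- The action of a quantum operation on operators. -/
def QuantumOperation.apply {d d' : ℕ} (N : QuantumOperation d d')
    (ρ : Matrix (Fin d) (Fin d) ℂ) : Matrix (Fin d') (Fin d') ℂ :=
  ∑ a, N.kraus a * ρ * (N.kraus a)ᴴ

/-- A partial measurement of a qubit, given by measurement operators `op k` with
`∑ k, (op k)† (op k) = id`: it yields a classical outcome `k` and leaves a quantum state
of dimension `d`. -/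
structure PartialMeasurement (d : ℕ) where
  outcomes : ℕ
  op : Fin outcomes → Matrix (Fin d) (Fin 2) ℂ
  complete : ∑ k, (op k)ᴴ * op k = 1

/-- The unnormalised state after outcome `k`; its trace is the probability of `k`. -/
def PartialMeasurement.post {d : ℕ} (P : PartialMeasurement d) (k : Fin P.outcomes)
    (ρ : Matrix (Fin 2) (Fin 2) ℂ) : Matrix (Fin d) (Fin d) ℂ :=
  P.op k * ρ * (P.op k)ᴴ

/-! ## BB84 encoding and storage -/

/-- The BB84 vector `|x⟩_θ`. The basis `+` is `θ = false`, the basis `×` is `θ = true`. -/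
def bb84Ket (x : ZMod 2) (θ : Bool) : Fin 2 → ℂ :=
  if θ then ![1 / (Real.sqrt 2 : ℂ), (if x = 0 then 1 else -1) / (Real.sqrt 2 : ℂ)]
  else if x = 0 then ![1, 0] else ![0, 1]

/-- The BB84 state `|x⟩⟨x|_θ`. -/
def bb84 (x : ZMod 2) (θ : Bool) : Matrix (Fin 2) (Fin 2) ℂ :=
  Matrix.vecMulVec (bb84Ket x θ) (star (bb84Ket x θ))

/-- `p_{k | xθ} · 𝒩(ρ_{xθ}^k)`: the partial measurement `P` has been applied to `|x⟩_θ` with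
outcome `k`, and what is left of the qubit has been stored under the noise `N`. -/
def storedState {d d' : ℕ} (P : PartialMeasurement d) (N : QuantumOperation d d')
    (k : Fin P.outcomes) (x : ZMod 2) (θ : Bool) : Matrix (Fin d') (Fin d') ℂ :=
  N.apply (P.post k (bb84 x θ))

/-- `H(X | Θ K E)` for one uniformly random bit `X`, encoded in a uniformly random basis `Θ`,
partially measured with outcome `K`, and stored in the noisy register `E`. -/
def roundEntropy {d d' : ℕ} (P : PartialMeasurement d) (N : QuantumOperation d d') : ℝ :=
  condEntropy fun (x : ZMod 2) (c : Bool × Fin P.outcomes) =>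
    (1 / 4 : ℂ) • storedState P N c.2 x c.1

/-- `t` is an uncertainty lower bound for the storage noise `𝒩₁, …, 𝒩ₙ`: whatever partial
measurement the receiver applies in round `i`, one has `H(X_i | Θ_i K_i E_i) ≥ t`. -/
def IsUncertaintyBound {n : ℕ} {d d' : Fin n → ℕ}
    (N : ∀ i, QuantumOperation (d i) (d' i)) (t : ℝ) : Prop :=
  ∀ (i : Fin n) (P : PartialMeasurement (d i)), t ≤ roundEntropy P (N i)

/-! ## The robust protocol -/

/-- Bit strings of length `n`. -/
abbrev BitString (n : ℕ) : Type := Fin n → ZMod 2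

/-- A family of functions, with uniformly random index, is two-universal if
`Pr[f(x) = f(y)] ≤ 2^(-ℓ)` for all `x ≠ y`. -/
def IsTwoUniversal {ι : Type*} [Fintype ι] {n ℓ : ℕ}
    (hash : ι → BitString n → BitString ℓ) : Prop :=
  ∀ x y : BitString n, x ≠ y →
    ((Finset.univ.filter fun f : ι => hash f x = hash f y).card : ℝ) / Fintype.card ι
      ≤ 1 / 2 ^ ℓ

/-- The string `x` restricted to the positions in `I`. -/
def restrict {n : ℕ} (x : BitString n) (I : Finset (Fin n)) : BitString I.card :=
  fun j => x (I.orderEmbOfFin rfl j)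

/-- A string padded with zeros to length `n`. -/
def padZero {m : ℕ} (n : ℕ) (x : BitString m) : BitString n :=
  fun j => if h : (j : ℕ) < m then x ⟨j, h⟩ else 0

/-- The public parameters of the protocol: the tolerated rates, a family of hash functions
indexed by a finite type `ι`, and, for every length `m`, the syndrome map of a binary linear
code of length `m` with `synLen m` parity checks. -/
structure RobustROT (n ℓ : ℕ) (ι : Type) where
  pErase : ℝ
  ε : ℝ
  hash : ι → BitString n → BitString ℓ
  synLen : ℕ → ℕ
  syn : ∀ m, BitString m →ₗ[ZMod 2] BitString (synLen m)

/-- An individual-storage attack. In round `i` the receiver applies the partial measurement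
`meas i` to the incoming qubit and stores what is left of it. He then claims, depending on
all his measurement outcomes, to have received exactly the qubits in `report k`. -/
structure StorageAttack {n : ℕ} (d : Fin n → ℕ) where
  meas : ∀ i, PartialMeasurement (d i)
  report : (∀ i, Fin (meas i).outcomes) → Finset (Fin n)

namespace RobustROT

variable {n ℓ : ℕ} {ι : Type}

/-- The number `m` of qubits in one basis lies in the interval accepted by Alice. -/
def Accepts (π : RobustROT n ℓ ι) (m : ℕ) : Prop :=
  (1 - π.pErase - π.ε) * n / 2 ≤ m ∧ (m : ℝ) ≤ (1 - π.pErase + π.ε) * n / 2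

/-- `I_b`: the positions among the remaining ones at which Alice used the basis `b`. -/
def positions (θ : Fin n → Bool) (R : Finset (Fin n)) (b : Bool) : Finset (Fin n) :=
  R.filter fun i => θ i = b

/-- Alice's output strings `S_b = F_b(X_{|I_b})`. -/
def outputs (π : RobustROT n ℓ ι) (x : BitString n) (I : Bool → Finset (Fin n))
    (F : Bool → ι) : Bool → BitString ℓ :=
  fun b => π.hash (F b) (padZero n (restrict x (I b)))

/-- The classical part of the receiver's final state: his outcomes `K`, the hash functions
`F_+`, `F_×`, the sets `I_+`, `I_×`, and the two syndromes. -/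
abbrev View (π : RobustROT n ℓ ι) {d : Fin n → ℕ} (A : StorageAttack d) : Type :=
  (∀ i, Fin (A.meas i).outcomes) × (Bool → ι) ×
    (Σ I : Bool → Finset (Fin n), ∀ b, BitString (π.synLen (I b).card))

/-- The classical information that the receiver holds at the end of a run. -/
def view (π : RobustROT n ℓ ι) {d : Fin n → ℕ} (A : StorageAttack d) (x : BitString n)
    (θ : Fin n → Bool) (k : ∀ i, Fin (A.meas i).outcomes) (F : Bool → ι) : π.View A :=
  (k, F, ⟨positions θ (A.report k),
    fun b => π.syn _ (restrict x (positions θ (A.report k) b))⟩)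

open Classical in
/-- The final state of honest Alice and the dishonest receiver, restricted to the runs in
which Alice does not abort. It is a state of Alice's strings `S_+`, `S_×`, the receiver's
classical information and his quantum registers `E_1 … E_n`, given by its blocks; its trace
is the probability that Alice does not abort. -/
def finalState [Fintype ι] (π : RobustROT n ℓ ι) {d d' : Fin n → ℕ}
    (N : ∀ i, QuantumOperation (d i) (d' i)) (A : StorageAttack d)
    (s : Bool → BitString ℓ) (v : π.View A) :
    Matrix (∀ i, Fin (d' i)) (∀ i, Fin (d' i)) ℂ :=
  ∑ x : BitString n, ∑ θ : Fin n → Bool, ∑ k : (∀ i, Fin (A.meas i).outcomes),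
    ∑ F : Bool → ι,
      if (∀ b, π.Accepts (positions θ (A.report k) b).card) ∧
          π.outputs x (positions θ (A.report k)) F = s ∧ π.view A x θ k F = v then
        ((2 : ℂ) ^ n * 2 ^ n * (Fintype.card ι : ℂ) ^ 2)⁻¹ •
          piTensor fun i => storedState (A.meas i) (N i) (k i) (x i) (θ i)
      else 0

open Classical in
/-- The protocol is secure with error `err` against a dishonest receiver with storage noise
`N`: for every individual-storage attack there is a random variable `D ∈ {+, ×}`, i.e. an
extension `τ` of the final state by a classical register `D`, such that
`d(S_{D̄} | S_D D ρ_B) ≤ err`. -/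
def SecureAgainstReceiver [Fintype ι] (π : RobustROT n ℓ ι)
    {d d' : Fin n → ℕ} (N : ∀ i, QuantumOperation (d i) (d' i)) (err : ℝ) : Prop :=
  ∀ A : StorageAttack d,
    ∃ τ : Bool → (Bool → BitString ℓ) → π.View A →
        Matrix (∀ i, Fin (d' i)) (∀ i, Fin (d' i)) ℂ,
      (∀ D s v, (τ D s v).PosSemidef) ∧
      (∀ s v, ∑ D, τ D s v = π.finalState N A s v) ∧
      nonUniformity (fun sOther : BitString ℓ =>
        Matrix.blockDiagonal fun c : BitString ℓ × Bool × π.View A =>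
          τ c.2.1 (fun b => if b = c.2.1 then c.1 else sOther) c.2.2) ≤ err

end RobustROT

end

/-! Once the bases and the outcomes `K` are fixed, the receiver holds a product of one-qubit storage
states. For positive operators `ρ x` with sum `σ`, let `r` be the eigenvalues of `ρ x`, `s` those of
`σ`. The numbers `r` times the squared overlaps of the eigenbases form a classical joint
distribution, with marginals `r` and `s`, under which `log (s / r)` has mean `H(X|E)`
(`blockEntropy_eq`). `leftover_hash` controls hashing against quantum memory by the tail event `r >
lam * s` of this distribution. For product states the ratios multiply, so a Chernoff bound with a
moment of small order `κ` applies (`spectralTail_piTensor_le`), and `overlapMoment_le` expands that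
moment to second order in `κ`: one minus `κ` times the entropy, plus `O(κ²)`.

The uncertainty bound is an average over the outcomes of a measurement, whereas the product is over
one outcome per round. Twirling a single measurement operator by the Pauli group turns it into a
complete measurement all of whose outcomes are equivalent to it, so `t` bounds the entropy, averaged
over the two bases, of every single outcome (`blockEntropy_add_ge`).

Write `φ_i(b)` for the normalised moment in round `i` and basis `b`, given the outcome. The tail
error for the string in basis `b` is governed by `√(∏_{i ∈ I_b} φ_i(b))`. The register `D` is
computed from `K`, `I_+`, `I_×` so that the string that must be uniform belongs to the smaller
product. The smaller product is at most the geometric mean of the two, which leaves `∏_{i ∈ R}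
φ_i(θ_i)^(1/4)`. The set `R` depends on `K` only and `K` is independent of the bases, so the mean
over the bases factorises, each round of `R` contributing at most `γ = exp(-(κ/4)(t log 2 - 9κ))`.
If Alice does not abort then `R` has at least `(1 - p_erase - ε) n` elements, and `δ` is tuned so
that this term is at most `ε`.

In the hashing term the bits outside `I_{D̄}` and the function `F_D` are simply fixed; they
determine `S_D` and the syndrome for `D`, so only the syndrome for `D̄` counts as leakage. The bound
on `ℓ` makes this term at most `ε` as well. -/

open scoped Matrix BigOperators ComplexOrder

noncomputable section

set_option linter.unusedSectionVars false

/-! ## Unitary diagonalisations -/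

/-- `A = U diag(a) U†` with `U` unitary and `a` real. -/
structure IsDiagonalization {d : Type*} [Fintype d] [DecidableEq d] (A U : Matrix d d ℂ)
    (a : d → ℝ) : Prop where
  unitary : Uᴴ * U = 1
  eq : A = U * Matrix.diagonal (fun i => (a i : ℂ)) * Uᴴ

namespace IsDiagonalization

variable {d : Type*} [Fintype d] [DecidableEq d] {A U : Matrix d d ℂ} {a : d → ℝ}

theorem unitary' (h : IsDiagonalization A U a) : U * Uᴴ = 1 :=
  mul_eq_one_comm.mp h.unitary

theorem isHermitian (h : IsDiagonalization A U a) : A.IsHermitian := by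
  rw [h.eq, Matrix.IsHermitian, Matrix.conjTranspose_mul, Matrix.conjTranspose_mul,
    Matrix.conjTranspose_conjTranspose, Matrix.diagonal_conjTranspose, Matrix.mul_assoc]
  congr 3
  ext i
  simp

theorem charpoly (h : IsDiagonalization A U a) :
    A.charpoly = ∏ i, (Polynomial.X - Polynomial.C (a i : ℂ)) := by
  rw [h.eq, Matrix.charpoly_mul_comm, ← mul_assoc, h.unitary, one_mul,
    Matrix.charpoly_diagonal]

/-- The characteristic polynomial fixes the multiset of the `a i`, so spectral functions can be
evaluated in any eigenbasis and with any indexing. Tensor products and block sums are therefore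
handled with their natural, unsorted eigenvalues. -/
theorem sum_eigenvalues (h : IsDiagonalization A U a) (f : ℝ → ℝ) :
    ∑ i, f (h.isHermitian.eigenvalues i) = ∑ i, f (a i) := by
  have h1 := h.isHermitian.roots_charpoly_eq_eigenvalues
  have h2 : A.charpoly.roots = Multiset.map (fun i => (a i : ℂ)) Finset.univ.val := by
    rw [h.charpoly]
    rw [← Polynomial.roots_multiset_prod_X_sub_C (Multiset.map (fun i => (a i : ℂ)) _),
      Multiset.map_map]
    rfl
  have h3 := congrArg (fun m : Multiset ℂ => (m.map (fun z => f z.re)).sum) (h1.symm.trans h2)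
  simp only [Multiset.map_map, Function.comp_def] at h3
  exact h3

theorem trace_cfc (h : IsDiagonalization A U a) (f : ℝ → ℝ) :
    (Matrix.trace (cfc f A)).re = ∑ i, f (a i) := by
  rw [h.isHermitian.cfc_eq, Matrix.IsHermitian.cfc, Unitary.conjStarAlgAut_apply,
    Matrix.trace_mul_comm, ← mul_assoc, Unitary.coe_star_mul_self, one_mul,
    Matrix.trace_diagonal, ← h.sum_eigenvalues f]
  simp

theorem vonNeumannEntropy_eq (h : IsDiagonalization A U a) :
    vonNeumannEntropy A = ∑ i, -(a i * Real.logb 2 (a i)) :=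
  h.trace_cfc _

theorem trace_eq (h : IsDiagonalization A U a) : A.trace = ∑ i, (a i : ℂ) := by
  rw [h.eq, Matrix.trace_mul_comm, ← mul_assoc, h.unitary, one_mul, Matrix.trace_diagonal]

theorem smul (h : IsDiagonalization A U a) (c : ℝ) :
    IsDiagonalization ((c : ℂ) • A) U (fun i => c * a i) := by
  refine ⟨h.unitary, ?_⟩
  rw [h.eq, ← Matrix.smul_mul, ← Matrix.mul_smul, ← Matrix.diagonal_smul]
  congr 3
  ext i
  simp

theorem blockDiagonal {ι : Type*} [Fintype ι] [DecidableEq ι] {A U : ι → Matrix d d ℂ}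
    {a : ι → d → ℝ} (h : ∀ i, IsDiagonalization (A i) (U i) (a i)) :
    IsDiagonalization (Matrix.blockDiagonal A) (Matrix.blockDiagonal U)
      (fun p => a p.2 p.1) := by
  constructor
  · rw [Matrix.blockDiagonal_conjTranspose, ← Matrix.blockDiagonal_mul,
      ← Matrix.blockDiagonal_one]
    congr 1
    funext i
    exact (h i).unitary
  · have : Matrix.diagonal (fun p : d × ι => (a p.2 p.1 : ℂ)) =
        Matrix.blockDiagonal fun i => Matrix.diagonal fun j => (a i j : ℂ) := by
      rw [Matrix.blockDiagonal_diagonal]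
    rw [this, Matrix.blockDiagonal_conjTranspose, ← Matrix.blockDiagonal_mul,
      ← Matrix.blockDiagonal_mul]
    congr 1
    funext i
    exact (h i).eq

theorem exists_of_isHermitian (hA : A.IsHermitian) :
    ∃ U : Matrix d d ℂ, IsDiagonalization A U hA.eigenvalues := by
  refine ⟨hA.eigenvectorUnitary, Unitary.coe_star_mul_self _, ?_⟩
  conv_lhs => rw [hA.spectral_theorem]
  rfl

theorem exists_of_posSemidef (hA : A.PosSemidef) :
    ∃ (U : Matrix d d ℂ) (a : d → ℝ), IsDiagonalization A U a ∧ ∀ i, 0 ≤ a i :=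
  let ⟨U, hU⟩ := exists_of_isHermitian hA.1
  ⟨U, _, hU, hA.eigenvalues_nonneg⟩

end IsDiagonalization

/-! ## The Frobenius norm and contractions -/

section Frobenius

variable {l m n : Type*} [Fintype l] [Fintype m] [Fintype n]

/-- The squared Frobenius norm. -/
def frobSq (A : Matrix m n ℂ) : ℝ := ∑ i, ∑ j, ‖A i j‖ ^ 2

theorem frobSq_nonneg (A : Matrix m n ℂ) : 0 ≤ frobSq A := by
  unfold frobSq; positivity

theorem abs_re_trace_mul_le (A : Matrix m n ℂ) (B : Matrix n m ℂ) :
    |(Matrix.trace (A * B)).re| ≤ √(frobSq A) * √(frobSq B) := by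
  calc |(Matrix.trace (A * B)).re| ≤ ‖Matrix.trace (A * B)‖ := Complex.abs_re_le_norm _
    _ = ‖∑ p : m × n, A p.1 p.2 * B p.2 p.1‖ := by
        rw [Fintype.sum_prod_type]; rfl
    _ ≤ ∑ p : m × n, ‖A p.1 p.2‖ * ‖B p.2 p.1‖ :=
        (norm_sum_le _ _).trans_eq (by simp)
    _ ≤ √(∑ p : m × n, ‖A p.1 p.2‖ ^ 2) * √(∑ p : m × n, ‖B p.2 p.1‖ ^ 2) :=
        Real.sum_mul_le_sqrt_mul_sqrt _ _ _
    _ = _ := by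
        rw [Fintype.sum_prod_type, Fintype.sum_prod_type_right]; rfl

theorem frobSq_eq_trace (A : Matrix m n ℂ) : frobSq A = (Matrix.trace (Aᴴ * A)).re := by
  unfold frobSq Matrix.trace
  rw [Finset.sum_comm]
  simp only [Matrix.diag, Matrix.mul_apply, Complex.re_sum]
  refine Finset.sum_congr rfl fun j _ => Finset.sum_congr rfl fun i _ => ?_
  rw [Matrix.conjTranspose_apply, Complex.star_def, ← Complex.normSq_eq_conj_mul_self,
    Complex.ofReal_re, Complex.normSq_eq_norm_sq]

theorem frobSq_isometry_mul [DecidableEq m] {U : Matrix l m ℂ} (hU : Uᴴ * U = 1)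
    (A : Matrix m n ℂ) : frobSq (U * A) = frobSq A := by
  rw [frobSq_eq_trace, frobSq_eq_trace, Matrix.conjTranspose_mul, Matrix.mul_assoc,
    ← Matrix.mul_assoc Uᴴ, hU, Matrix.one_mul]

theorem frobSq_conjTranspose (A : Matrix m n ℂ) : frobSq Aᴴ = frobSq A := by
  unfold frobSq
  rw [Finset.sum_comm]
  simp

theorem frobSq_diagonal [DecidableEq m] (v : m → ℂ) :
    frobSq (Matrix.diagonal v) = ∑ i, ‖v i‖ ^ 2 := by
  unfold frobSq
  refine Finset.sum_congr rfl fun i _ => ?_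
  rw [Finset.sum_eq_single i] <;> simp +contextual [eq_comm]

/-- `W W† ≤ id`. -/
def IsRowContraction (W : Matrix m m ℂ) : Prop :=
  ∀ v : m → ℂ, ∑ j, ‖(v ᵥ* W) j‖ ^ 2 ≤ ∑ i, ‖v i‖ ^ 2

theorem IsRowContraction.frobSq_mul_le {W : Matrix m m ℂ} (hW : IsRowContraction W)
    (Y : Matrix l m ℂ) : frobSq (Y * W) ≤ frobSq Y :=
  Finset.sum_le_sum fun i _ => hW (Y i)

/-- Test vectors supported in the block `k` suffice: the output outside the block only adds to the
left-hand norm. -/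
theorem IsRowContraction.block {ι : Type*} [Fintype ι] [DecidableEq ι]
    {W : Matrix (m × ι) (m × ι) ℂ} (hW : IsRowContraction W) (k : ι) :
    IsRowContraction (Matrix.of fun i j => W (i, k) (j, k)) := by
  intro v
  have h := hW (fun p => if p.2 = k then v p.1 else 0)
  have h1 : ∑ p : m × ι, ‖(if p.2 = k then v p.1 else 0 : ℂ)‖ ^ 2 = ∑ i, ‖v i‖ ^ 2 := by
    rw [Fintype.sum_prod_type]
    refine Finset.sum_congr rfl fun i _ => ?_
    rw [Finset.sum_eq_single k] <;> simp +contextual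
  rw [h1] at h
  refine le_trans ?_ h
  rw [Fintype.sum_prod_type]
  refine Finset.sum_le_sum fun j _ => ?_
  refine le_trans (le_of_eq ?_)
    (Finset.single_le_sum (fun _ _ => by positivity) (Finset.mem_univ k))
  congr 2
  simp only [Matrix.vecMul, dotProduct, Matrix.of_apply, Fintype.sum_prod_type, ite_mul,
    zero_mul, Finset.sum_ite_eq', Finset.mem_univ, if_true]

/-- The diagonal blocks of `W`, paired with the blocks of a block-diagonal matrix. -/
theorem trace_mul_blockDiagonal {ι : Type*} [Fintype ι] [DecidableEq ι]
    (W : Matrix (m × ι) (m × ι) ℂ) (A : ι → Matrix m m ℂ) :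
    Matrix.trace (W * Matrix.blockDiagonal A) =
      ∑ k, Matrix.trace ((Matrix.of fun i j => W (i, k) (j, k)) * A k) := by
  simp only [Matrix.trace, Matrix.diag, Matrix.mul_apply, Matrix.of_apply,
    Matrix.blockDiagonal_apply]
  rw [Fintype.sum_prod_type_right]
  refine Finset.sum_congr rfl fun k _ => Finset.sum_congr rfl fun i _ => ?_
  rw [Fintype.sum_prod_type]
  refine Finset.sum_congr rfl fun j _ => ?_
  rw [Finset.sum_eq_single k] <;> simp +contextual

end Frobenius

/-! ### The trace norm as an optimum over contractions -/

section TraceNorm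

variable {d : Type*} [Fintype d] [DecidableEq d]

/-- In the eigenbasis of `W W†` the norm of `v W` is a weighted sum with weights `a i ≤ 1`, and `U`
preserves the norm of `v`. The vector is treated as a one-row matrix so that the Frobenius
identities apply. -/
theorem isRowContraction_of_diagonalization {W U : Matrix d d ℂ} {a : d → ℝ}
    (h : IsDiagonalization (W * Wᴴ) U a) (ha : ∀ i, a i ≤ 1) : IsRowContraction W := by
  intro v
  set w : Matrix Unit d ℂ := Matrix.of fun _ => v
  have e1 : ∑ j, ‖(v ᵥ* W) j‖ ^ 2 = frobSq (w * W) := by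
    simp [frobSq, w, Matrix.mul_apply, Matrix.vecMul, dotProduct]
  have e2 : ∑ i, ‖v i‖ ^ 2 = frobSq (w * U) := by
    have : frobSq (w * U) = frobSq wᴴ := by
      rw [← frobSq_conjTranspose, Matrix.conjTranspose_mul]
      exact frobSq_isometry_mul (by simpa using h.unitary') _
    rw [this, frobSq_conjTranspose]
    simp [frobSq, w]
  have e3 : frobSq (w * W) = ∑ i, a i * ‖(w * U) () i‖ ^ 2 := by
    rw [← frobSq_conjTranspose, frobSq_eq_trace, Matrix.conjTranspose_conjTranspose,
      Matrix.conjTranspose_mul, Matrix.mul_assoc, ← Matrix.mul_assoc W, h.eq,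
      show w * (U * Matrix.diagonal (fun i => (a i : ℂ)) * Uᴴ * wᴴ) =
        (w * U) * Matrix.diagonal (fun i => (a i : ℂ)) * (w * U)ᴴ by
        rw [Matrix.conjTranspose_mul]; simp only [Matrix.mul_assoc]]
    simp only [Matrix.trace, Matrix.diag, Finset.univ_unique, Finset.sum_singleton]
    rw [Matrix.mul_apply, Complex.re_sum]
    simp only [Matrix.mul_diagonal, Matrix.conjTranspose_apply]
    refine Finset.sum_congr rfl fun i _ => ?_
    rw [mul_right_comm, Complex.star_def, Complex.mul_conj, Complex.normSq_eq_norm_sq,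
      ← Complex.ofReal_mul, Complex.ofReal_re, mul_comm]
  rw [e1, e2, e3]
  simp only [frobSq, Finset.univ_unique, Finset.sum_singleton]
  exact Finset.sum_le_sum fun i _ => mul_le_of_le_one_left (by positivity) (ha i)

/-- The trace norm is attained: `‖A‖₁ = Re Tr (W A)` for some contraction `W`. -/
theorem exists_contraction_traceNorm (A : Matrix d d ℂ) :
    ∃ W : Matrix d d ℂ, IsRowContraction W ∧ traceNorm A = (Matrix.trace (W * A)).re := by
  obtain ⟨Q, μ, hQ, hμ⟩ := IsDiagonalization.exists_of_posSemidef
    (Matrix.posSemidef_conjTranspose_mul_self A)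
  -- Since `0⁻¹ = 0`, `P` is the pseudo-inverse of `√(A†A)`, and `P A†` is the adjoint of the
  -- partial isometry in the polar decomposition of `A`.
  set c : d → ℝ := fun i => (√(μ i))⁻¹
  set P : Matrix d d ℂ := Q * Matrix.diagonal (fun i => (c i : ℂ)) * Qᴴ
  have hP : Pᴴ = P := (IsDiagonalization.mk (A := P) hQ.unitary rfl).isHermitian
  have key : ∀ u v : d → ℝ, Q * Matrix.diagonal (fun i => (u i : ℂ)) * Qᴴ *
      (Q * Matrix.diagonal (fun i => (v i : ℂ)) * Qᴴ) =
      Q * Matrix.diagonal (fun i => ((u i * v i : ℝ) : ℂ)) * Qᴴ := by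
    intro u v
    calc _ = Q * Matrix.diagonal (fun i => (u i : ℂ)) * (Qᴴ * Q) *
        Matrix.diagonal (fun i => (v i : ℂ)) * Qᴴ := by simp only [Matrix.mul_assoc]
      _ = _ := by
        rw [hQ.unitary, Matrix.mul_one, Matrix.mul_assoc Q, Matrix.diagonal_mul_diagonal]
        simp
  refine ⟨P * Aᴴ, ?_, ?_⟩
  · refine isRowContraction_of_diagonalization (U := Q) (a := fun i => c i * μ i * c i)
      ⟨hQ.unitary, ?_⟩ fun i => ?_
    · rw [Matrix.conjTranspose_mul, Matrix.conjTranspose_conjTranspose, hP,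
        Matrix.mul_assoc, ← Matrix.mul_assoc Aᴴ, ← Matrix.mul_assoc, hQ.eq, key, key]
    · simp only [c]
      rcases (hμ i).eq_or_lt with h | h
      · simp [← h]
      · have := Real.mul_self_sqrt (hμ i)
        have h' := Real.sqrt_pos.mpr h
        rw [mul_right_comm, ← mul_inv, this, inv_mul_cancel₀ h.ne']
  · have hWA : IsDiagonalization (P * Aᴴ * A) Q (fun i => c i * μ i) :=
      ⟨hQ.unitary, by rw [Matrix.mul_assoc, hQ.eq, key]⟩
    rw [traceNorm, hQ.trace_cfc, hWA.trace_eq, Complex.re_sum]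
    refine Finset.sum_congr rfl fun i _ => ?_
    rw [Complex.ofReal_re]
    rcases (hμ i).eq_or_lt with h | h
    · simp [← h]
    · have := Real.mul_self_sqrt (hμ i)
      have h' := Real.sqrt_pos.mpr h
      simp only [c]
      field_simp
      nlinarith

/-- With `A = B†B` the trace is that of `(B W) B†`. Cauchy–Schwarz and the contraction property
bound it by the squared Frobenius norm of `B`, which is the trace of `A`. -/
theorem abs_re_trace_contraction_mul_le {W A : Matrix d d ℂ} (hW : IsRowContraction W)
    (hA : A.PosSemidef) : |(Matrix.trace (W * A)).re| ≤ A.trace.re := by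
  obtain ⟨B, rfl⟩ : ∃ B : Matrix d d ℂ, A = Bᴴ * B := by
    open scoped MatrixOrder in
    exact CStarAlgebra.nonneg_iff_eq_star_mul_self.mp hA.nonneg
  rw [← frobSq_eq_trace, ← Matrix.mul_assoc, Matrix.trace_mul_comm, ← Matrix.mul_assoc]
  refine (abs_re_trace_mul_le _ _).trans ?_
  rw [frobSq_conjTranspose]
  calc _ ≤ √(frobSq B) * √(frobSq B) := by
        gcongr
        exact hW.frobSq_mul_le B
    _ = _ := Real.mul_self_sqrt (frobSq_nonneg _)

end TraceNorm

/-! ## The leftover hash lemma against quantum side information -/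

section LeftoverHash

variable {ι Y S C E : Type*} [Fintype ι] [Fintype Y] [DecidableEq Y] [Fintype S]
  [DecidableEq S] [Fintype C] [DecidableEq C] [Fintype E] [DecidableEq E]

/-- `1 / |S| - [f y = z]`. -/
def hashDeviation (hash : ι → Y → S) (f : ι) (z : S) (y : Y) : ℝ :=
  (Fintype.card S : ℝ)⁻¹ - if hash f y = z then 1 else 0

theorem sum_hashDeviation_mul [Nonempty S] (hash : ι → Y → S) (f : ι) (y y' : Y) :
    ∑ z, hashDeviation hash f z y * hashDeviation hash f z y' =
      (if hash f y = hash f y' then 1 else 0) - (Fintype.card S : ℝ)⁻¹ := by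
  have hS : (Fintype.card S : ℝ) ≠ 0 := by exact_mod_cast Fintype.card_ne_zero
  simp only [hashDeviation, sub_mul, mul_sub, Finset.sum_sub_distrib, ite_mul, mul_ite,
    one_mul, zero_mul, mul_one, mul_zero, Finset.sum_const, Finset.card_univ, nsmul_eq_mul,
    Finset.sum_ite_eq, Finset.mem_univ, if_true]
  field_simp
  by_cases h : hash f y = hash f y' <;> simp [h]

theorem sum_abs_hashDeviation_le [Nonempty S] (hash : ι → Y → S) (f : ι) (y : Y) :
    ∑ z, |hashDeviation hash f z y| ≤ 2 := by
  have hS : (Fintype.card S : ℝ) ≠ 0 := by exact_mod_cast Fintype.card_ne_zero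
  calc ∑ z, |hashDeviation hash f z y|
      ≤ ∑ z, ((Fintype.card S : ℝ)⁻¹ + if hash f y = z then 1 else 0) := by
        refine Finset.sum_le_sum fun z _ => (abs_sub _ _).trans (le_of_eq ?_)
        rw [abs_of_nonneg (by positivity), abs_of_nonneg (by split_ifs <;> norm_num)]
    _ = 2 := by
        simp only [Finset.sum_add_distrib, Finset.sum_const, Finset.card_univ, nsmul_eq_mul,
          Finset.sum_ite_eq, Finset.mem_univ, if_true]
        rw [mul_inv_cancel₀ hS]
        norm_num

variable {hash : ι → Y → S}

/-- The left side is a quadratic form in `v` whose off-diagonal coefficients are nonpositive by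
two-universality. They may be very negative, which hurts when the entries of `v` have mixed signs.
Adding the nonnegative value of the form at `|v|` turns each product `v y * v y'` into a nonnegative
number, after which the off-diagonal part can be dropped; the price is the factor 2. -/
theorem sum_sq_hashDeviation_le [Nonempty S]
    (h2 : ∀ y y', y ≠ y' → ((Finset.univ.filter fun f => hash f y = hash f y').card : ℝ) *
      Fintype.card S ≤ Fintype.card ι) (v : Y → ℝ) :
    ∑ f, ∑ z, (∑ y, hashDeviation hash f z y * v y) ^ 2 ≤
      2 * Fintype.card ι * ∑ y, v y ^ 2 := by
  have hS : (0 : ℝ) < Fintype.card S := by exact_mod_cast Fintype.card_pos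
  set G : Y → Y → ℝ := fun y y' =>
    ∑ f, ∑ z, hashDeviation hash f z y * hashDeviation hash f z y'
  have hQ : ∀ v : Y → ℝ, ∑ f, ∑ z, (∑ y, hashDeviation hash f z y * v y) ^ 2 =
      ∑ y, ∑ y', G y y' * (v y * v y') := by
    intro v
    simp only [G, pow_two, Finset.sum_mul_sum]
    simp only [Finset.sum_mul]
    calc _ = ∑ f, ∑ y, ∑ y', ∑ z, hashDeviation hash f z y * hashDeviation hash f z y' *
          (v y * v y') := by
          refine Finset.sum_congr rfl fun f _ => ?_
          rw [Finset.sum_comm]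
          refine Finset.sum_congr rfl fun y _ => ?_
          rw [Finset.sum_comm]
          refine Finset.sum_congr rfl fun y' _ => Finset.sum_congr rfl fun z _ => ?_
          ring
      _ = _ := by
          rw [Finset.sum_comm]
          refine Finset.sum_congr rfl fun y _ => ?_
          rw [Finset.sum_comm]
  have hG : ∀ y y', G y y' = (Finset.univ.filter fun f => hash f y = hash f y').card -
      Fintype.card ι * (Fintype.card S : ℝ)⁻¹ := by
    intro y y'
    simp only [G, sum_hashDeviation_mul, Finset.sum_sub_distrib, Finset.sum_boole,
      Finset.sum_const, Finset.card_univ, nsmul_eq_mul]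
  have hdiag : ∀ y, G y y ≤ Fintype.card ι := by
    intro y
    rw [hG]
    simp only [Finset.filter_true, Finset.card_univ]
    have : (0 : ℝ) ≤ Fintype.card ι * (Fintype.card S : ℝ)⁻¹ := by positivity
    linarith
  have hoff : ∀ y y', y ≠ y' → G y y' ≤ 0 := by
    intro y y' h
    rw [hG, sub_nonpos, ← div_eq_mul_inv, le_div_iff₀ hS]
    exact h2 y y' h
  have hpos : 0 ≤ ∑ y, ∑ y', G y y' * (|v y| * |v y'|) := by
    rw [← hQ]; positivity
  rw [hQ]
  calc ∑ y, ∑ y', G y y' * (v y * v y')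
      ≤ ∑ y, ∑ y', G y y' * (v y * v y') + ∑ y, ∑ y', G y y' * (|v y| * |v y'|) := by
        linarith
    _ = ∑ y, ∑ y', G y y' * (v y * v y' + |v y| * |v y'|) := by
        simp only [mul_add, Finset.sum_add_distrib]
    _ ≤ ∑ y, ∑ y', if y = y' then 2 * Fintype.card ι * v y ^ 2 else 0 := by
        refine Finset.sum_le_sum fun y _ => Finset.sum_le_sum fun y' _ => ?_
        split_ifs with h
        · subst h
          rw [abs_mul_abs_self]
          nlinarith [hdiag y, mul_self_nonneg (v y)]
        · refine mul_nonpos_of_nonpos_of_nonneg (hoff _ _ h) ?_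
          rw [← abs_mul]
          linarith [neg_abs_le (v y * v y')]
    _ = _ := by simp [Finset.mul_sum]

/-- The scalar bound is applied to the real and imaginary parts of each matrix entry. -/
theorem sum_frobSq_hashDeviation_le [Nonempty S]
    (h2 : ∀ y y', y ≠ y' → ((Finset.univ.filter fun f => hash f y = hash f y').card : ℝ) *
      Fintype.card S ≤ Fintype.card ι) (B : Y → Matrix E E ℂ) :
    ∑ f, ∑ z, frobSq (∑ y, (hashDeviation hash f z y : ℂ) • B y) ≤
      2 * Fintype.card ι * ∑ y, frobSq (B y) := by
  have e : ∀ g : Y → ℝ, ∀ a b, ‖(∑ y, (g y : ℂ) • B y) a b‖ ^ 2 =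
      (∑ y, g y * (B y a b).re) ^ 2 + (∑ y, g y * (B y a b).im) ^ 2 := by
    intro g a b
    rw [← Complex.normSq_eq_norm_sq, Complex.normSq_apply, Matrix.sum_apply]
    simp [Complex.re_sum, Complex.im_sum, sq]
  calc _ = ∑ a, ∑ b, (∑ f, ∑ z, (∑ y, hashDeviation hash f z y * (B y a b).re) ^ 2 +
        ∑ f, ∑ z, (∑ y, hashDeviation hash f z y * (B y a b).im) ^ 2) := by
        simp only [frobSq, e, ← Finset.sum_add_distrib]
        calc _ = ∑ f, ∑ a, ∑ z, _ := Finset.sum_congr rfl fun f _ => Finset.sum_comm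
          _ = ∑ a, ∑ f, ∑ z, _ := Finset.sum_comm
          _ = ∑ a, ∑ f, ∑ b, ∑ z, _ := Finset.sum_congr rfl fun a _ =>
            Finset.sum_congr rfl fun f _ => Finset.sum_comm
          _ = _ := Finset.sum_congr rfl fun a _ => Finset.sum_comm
    _ ≤ ∑ a, ∑ b, (2 * Fintype.card ι * ∑ y, (B y a b).re ^ 2 +
        2 * Fintype.card ι * ∑ y, (B y a b).im ^ 2) := by
        refine Finset.sum_le_sum fun a _ => Finset.sum_le_sum fun b _ => ?_
        exact add_le_add (sum_sq_hashDeviation_le h2 _) (sum_sq_hashDeviation_le h2 _)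
    _ = _ := by
        simp only [frobSq, ← mul_add, ← Finset.sum_add_distrib, ← Finset.mul_sum]
        congr 1
        calc _ = ∑ a, ∑ y, ∑ b, _ := Finset.sum_congr rfl fun a _ => Finset.sum_comm
          _ = ∑ y, ∑ a, ∑ b, _ := Finset.sum_comm
          _ = _ := by
            refine Finset.sum_congr rfl fun y _ => Finset.sum_congr rfl fun a _ =>
              Finset.sum_congr rfl fun b _ => ?_
            rw [← Complex.normSq_eq_norm_sq, Complex.normSq_apply, sq, sq]

/-- The part of a state whose eigenvalues exceed `lam` times those of a reference operator,
weighed with the squared overlaps of the two eigenbases. -/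
def spectralTail (lam : ℝ) (r s : E → ℝ) (K : Matrix E E ℂ) : ℝ :=
  ∑ a, ∑ b, if lam * s b < r a then r a * ‖K a b‖ ^ 2 else 0

theorem spectralTail_nonneg {lam : ℝ} {r s : E → ℝ} (hr : ∀ a, 0 ≤ r a)
    (K : Matrix E E ℂ) : 0 ≤ spectralTail lam r s K :=
  Finset.sum_nonneg fun a _ => Finset.sum_nonneg fun b _ => by
    have := hr a
    split_ifs <;> positivity

theorem sum_norm_sq_row {K : Matrix E E ℂ} (hK : K * Kᴴ = 1) (a : E) :
    ∑ b, ‖K a b‖ ^ 2 = 1 := by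
  have h := congrFun (congrFun hK a) a
  rw [Matrix.mul_apply, Matrix.one_apply_eq] at h
  have h' := congrArg Complex.re h
  rw [Complex.re_sum, Complex.one_re] at h'
  rw [← h']
  refine Finset.sum_congr rfl fun b _ => ?_
  rw [Matrix.conjTranspose_apply, Complex.star_def, Complex.mul_conj, Complex.ofReal_re,
    Complex.normSq_eq_norm_sq]

/-- The test sees only `f`, `z` and the leaked value `c`, and `Z` is common to all strings. The sum
over the strings with `syn y = c` can thus be taken first, so that the hash deviations cancel inside
the Frobenius norm. Cauchy–Schwarz over the triples `(f, z, c)` then puts the factors `|S|` and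
`|C|` under the root. -/
theorem sum_re_trace_hashDeviation_le [Nonempty S]
    (h2 : ∀ y y', y ≠ y' → ((Finset.univ.filter fun f => hash f y = hash f y').card : ℝ) *
      Fintype.card S ≤ Fintype.card ι) (syn : Y → C) {W : ι → S → C → Matrix E E ℂ}
    (hW : ∀ f z c, IsRowContraction (W f z c)) (Z : Matrix E E ℂ) (X : Y → Matrix E E ℂ) :
    ∑ f, ∑ y, ∑ z, hashDeviation hash f z y *
      (Matrix.trace ((Z * W f z (syn y)) * X y)).re ≤
      Fintype.card ι * √(2 * Fintype.card S * Fintype.card C * frobSq Z *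
        ∑ y, frobSq (X y)) := by
  set T : ι × S × C → Matrix E E ℂ := fun p =>
    ∑ y, (hashDeviation hash p.1 p.2.1 y : ℂ) • (if syn y = p.2.2 then X y else 0) with hTdef
  have hT : ∑ p, frobSq (T p) ≤ 2 * Fintype.card ι * ∑ y, frobSq (X y) := by
    calc ∑ p, frobSq (T p) = ∑ c, ∑ f, ∑ z, frobSq (T (f, z, c)) := by
          rw [Fintype.sum_prod_type]
          simp only [Fintype.sum_prod_type]
          calc _ = ∑ f, ∑ c, ∑ z, frobSq (T (f, z, c)) :=
              Finset.sum_congr rfl fun f _ => Finset.sum_comm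
            _ = _ := Finset.sum_comm
      _ ≤ ∑ c, 2 * Fintype.card ι * ∑ y, frobSq (if syn y = c then X y else 0) :=
          Finset.sum_le_sum fun c _ =>
            sum_frobSq_hashDeviation_le h2 fun y => if syn y = c then X y else 0
      _ = 2 * Fintype.card ι * ∑ y, frobSq (X y) := by
          rw [← Finset.mul_sum, Finset.sum_comm]
          congr 1
          refine Finset.sum_congr rfl fun y _ => ?_
          rw [Finset.sum_eq_single (syn y)]
          · simp
          · intro c _ hc
            rw [if_neg (Ne.symm hc)]
            simp [frobSq]
          · simp
  have hX : 0 ≤ ∑ y, frobSq (X y) := Finset.sum_nonneg fun y _ => frobSq_nonneg _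
  have hZ := frobSq_nonneg Z
  calc _ = ∑ p : ι × S × C, (Matrix.trace ((Z * W p.1 p.2.1 p.2.2) * T p)).re := by
        simp only [hTdef, Fintype.sum_prod_type, Matrix.mul_sum, Matrix.trace_sum,
          Matrix.mul_smul, Matrix.trace_smul, Complex.re_sum, smul_eq_mul,
          Complex.re_ofReal_mul]
        refine Finset.sum_congr rfl fun f _ => ?_
        rw [Finset.sum_comm]
        refine Finset.sum_congr rfl fun z _ => ?_
        rw [Finset.sum_comm]
        refine Finset.sum_congr rfl fun y _ => ?_
        rw [Finset.sum_eq_single (syn y)]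
        · simp
        · intro c _ hc
          rw [if_neg (Ne.symm hc)]
          simp
        · simp
    _ ≤ ∑ p : ι × S × C, √(frobSq Z) * √(frobSq (T p)) := by
        refine Finset.sum_le_sum fun p _ =>
          (le_abs_self _).trans ((abs_re_trace_mul_le _ _).trans ?_)
        gcongr
        exact (hW _ _ _).frobSq_mul_le _
    _ = √(frobSq Z) * ∑ p : ι × S × C, √1 * √(frobSq (T p)) := by
        simp only [Finset.mul_sum, Real.sqrt_one, one_mul]
    _ ≤ √(frobSq Z) * (√(∑ p : ι × S × C, 1) * √(∑ p, frobSq (T p))) := by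
        gcongr
        exact Real.sum_sqrt_mul_sqrt_le _ (fun _ => zero_le_one) (fun _ => frobSq_nonneg _)
    _ ≤ √(frobSq Z) * (√(Fintype.card ι * (Fintype.card S * Fintype.card C)) *
        √(2 * Fintype.card ι * ∑ y, frobSq (X y))) := by
        refine mul_le_mul_of_nonneg_left (mul_le_mul (Real.sqrt_le_sqrt ?_)
          (Real.sqrt_le_sqrt hT) (Real.sqrt_nonneg _) (Real.sqrt_nonneg _))
          (Real.sqrt_nonneg _)
        simp
    _ = √((Fintype.card ι : ℝ) ^ 2 * (2 * Fintype.card S * Fintype.card C * frobSq Z *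
          ∑ y, frobSq (X y))) := by
        rw [← Real.sqrt_mul (by positivity), ← Real.sqrt_mul hZ]
        congr 1
        ring
    _ = _ := by
        rw [Real.sqrt_mul (by positivity), Real.sqrt_sq (by positivity)]

/-- When the left factor depends on the string there is no cancellation to exploit. The triangle
inequality costs no factor `|S|` or `|C|`, only 2, which is good enough for the tail. -/
theorem sum_re_trace_hashDeviation_le' [Nonempty S] (syn : Y → C)
    {W : ι → S → C → Matrix E E ℂ} (hW : ∀ f z c, IsRowContraction (W f z c))
    (Z X : Y → Matrix E E ℂ) :
    ∑ f, ∑ y, ∑ z, hashDeviation hash f z y *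
      (Matrix.trace ((Z y * W f z (syn y)) * X y)).re ≤
      Fintype.card ι * (2 * ∑ y, √(frobSq (Z y)) * √(frobSq (X y))) := by
  calc _ ≤ ∑ f : ι, ∑ y, ∑ z, |hashDeviation hash f z y| *
        (√(frobSq (Z y)) * √(frobSq (X y))) := by
        refine Finset.sum_le_sum fun f _ => Finset.sum_le_sum fun y _ =>
          Finset.sum_le_sum fun z _ => ?_
        refine (le_abs_self _).trans ?_
        rw [abs_mul]
        gcongr
        refine (abs_re_trace_mul_le _ _).trans ?_
        gcongr
        exact (hW _ _ _).frobSq_mul_le _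
    _ ≤ ∑ _f : ι, ∑ y, 2 * (√(frobSq (Z y)) * √(frobSq (X y))) := by
        refine Finset.sum_le_sum fun f _ => Finset.sum_le_sum fun y _ => ?_
        rw [← Finset.sum_mul]
        gcongr
        exact sum_abs_hashDeviation_le _ _ _
    _ = _ := by
        rw [Finset.sum_const, Finset.card_univ, nsmul_eq_mul, ← Finset.mul_sum]

/-- A leftover hash lemma: the strings `y`, of which `syn y` is leaked, are hashed in the
presence of the states `ρ y`. The reference operator is `V diag(s) V†`, and the tests that
try to tell the hash value from uniform are the contractions `W`. -/
theorem leftover_hash [Nonempty S]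
    (h2 : ∀ y y', y ≠ y' → ((Finset.univ.filter fun f => hash f y = hash f y').card : ℝ) *
      Fintype.card S ≤ Fintype.card ι) (syn : Y → C)
    {ρ U : Y → Matrix E E ℂ} {r : Y → E → ℝ} (hρ : ∀ y, IsDiagonalization (ρ y) (U y) (r y))
    (hr : ∀ y a, 0 ≤ r y a) {V : Matrix E E ℂ} (hV : Vᴴ * V = 1) {s : E → ℝ}
    (hs : ∀ b, 0 ≤ s b) {lam : ℝ} (hlam : 0 ≤ lam) {W : ι → S → C → Matrix E E ℂ}
    (hW : ∀ f z c, IsRowContraction (W f z c)) :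
    ∑ f, ∑ y, ∑ z, hashDeviation hash f z y * (Matrix.trace (W f z (syn y) * ρ y)).re ≤
      Fintype.card ι * (√(2 * lam * Fintype.card S * Fintype.card C *
          (∑ y, ∑ a, r y a) * ∑ b, s b) +
        2 * √((∑ y, ∑ a, r y a) * ∑ y, spectralTail lam (r y) s ((U y)ᴴ * V))) := by
  have hV' : V * Vᴴ = 1 := mul_eq_one_comm.mp hV
  set K : Y → Matrix E E ℂ := fun y => (U y)ᴴ * V
  have hK : ∀ y, K y * (K y)ᴴ = 1 := fun y => by
    simp only [K, Matrix.conjTranspose_mul, Matrix.conjTranspose_conjTranspose]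
    rw [Matrix.mul_assoc, ← Matrix.mul_assoc V, hV', Matrix.one_mul, (hρ y).unitary]
  -- In the two eigenbases `ρ y` is the matrix `diag(r) K`. Entries with `r ≤ lam * s` go to `G`,
  -- divided by `√s` so that the reference operator can be split off as a factor independent of `y`;
  -- the others go to `B`.
  set G : Y → Matrix E E ℂ := fun y => Matrix.of fun a b =>
    if lam * s b < r y a then 0 else (r y a : ℂ) * K y a b / (√(s b) : ℂ)
  set B : Y → Matrix E E ℂ := fun y => Matrix.of fun a b =>
    if lam * s b < r y a then (√(r y a) : ℂ) * K y a b else 0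
  set Ds : Matrix E E ℂ := Matrix.diagonal fun b => (√(s b) : ℂ)
  set Dr : Y → Matrix E E ℂ := fun y => Matrix.diagonal fun a => (√(r y a) : ℂ)
  have hsplit : ∀ y, Matrix.diagonal (fun a => (r y a : ℂ)) * K y =
      G y * Ds + Dr y * B y := by
    intro y
    ext a b
    simp only [Matrix.add_apply, G, B, Ds, Dr, Matrix.diagonal_mul, Matrix.mul_diagonal,
      Matrix.of_apply]
    split_ifs with h
    · rw [zero_mul, zero_add, ← mul_assoc, ← Complex.ofReal_mul, Real.mul_self_sqrt (hr y a)]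
    -- An entry kept in `G` with `s b = 0` has `r y a = 0`, so the division by zero loses nothing.
    · rcases (hs b).eq_or_lt with h0 | h0
      · have : r y a = 0 := le_antisymm (by simpa [← h0] using h) (hr y a)
        simp [this]
      · have : (√(s b) : ℂ) ≠ 0 := by
          exact_mod_cast (Real.sqrt_pos.mpr h0).ne'
        field_simp
        simp
  have htr : ∀ y (w : Matrix E E ℂ), Matrix.trace (w * ρ y) =
      Matrix.trace ((Ds * Vᴴ * w) * (U y * G y)) +
        Matrix.trace ((B y * Vᴴ * w) * (U y * Dr y)) := by
    intro y w
    have : ρ y = U y * (G y * Ds + Dr y * B y) * Vᴴ := by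
      rw [← hsplit, (hρ y).eq]
      simp only [K, Matrix.mul_assoc, hV', Matrix.mul_one]
    rw [this, Matrix.mul_add, Matrix.add_mul, Matrix.mul_add, Matrix.trace_add]
    congr 1
    · rw [← Matrix.mul_assoc (U y), Matrix.mul_assoc (U y * G y), ← Matrix.mul_assoc w,
        Matrix.trace_mul_comm, ← Matrix.mul_assoc]
    · rw [← Matrix.mul_assoc (U y), Matrix.mul_assoc (U y * Dr y), ← Matrix.mul_assoc w,
        Matrix.trace_mul_comm, ← Matrix.mul_assoc]
  have hDsV : frobSq (Ds * Vᴴ) = ∑ b, s b := by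
    rw [← frobSq_conjTranspose, Matrix.conjTranspose_mul, Matrix.conjTranspose_conjTranspose,
      frobSq_isometry_mul hV, frobSq_conjTranspose, frobSq_diagonal]
    refine Finset.sum_congr rfl fun b _ => ?_
    rw [Complex.norm_real, Real.norm_eq_abs, sq_abs, Real.sq_sqrt (hs b)]
  have hDr : ∀ y, frobSq (U y * Dr y) = ∑ a, r y a := by
    intro y
    rw [frobSq_isometry_mul (hρ y).unitary, frobSq_diagonal]
    refine Finset.sum_congr rfl fun b _ => ?_
    rw [Complex.norm_real, Real.norm_eq_abs, sq_abs, Real.sq_sqrt (hr y b)]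
  have hBV : ∀ y, frobSq (B y * Vᴴ) = spectralTail lam (r y) s (K y) := by
    intro y
    rw [← frobSq_conjTranspose, Matrix.conjTranspose_mul, Matrix.conjTranspose_conjTranspose,
      frobSq_isometry_mul hV, frobSq_conjTranspose]
    refine Finset.sum_congr rfl fun a _ => Finset.sum_congr rfl fun b _ => ?_
    simp only [B, Matrix.of_apply]
    split_ifs
    · rw [norm_mul, mul_pow, Complex.norm_real, Real.norm_eq_abs, sq_abs,
        Real.sq_sqrt (hr y a)]
    · simp
  -- On the entries kept in `G` one has `r² / s ≤ lam * r`, and the rows of the overlap matrix have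
  -- norm one.
  have hG : ∀ y, frobSq (U y * G y) ≤ lam * ∑ a, r y a := by
    intro y
    rw [frobSq_isometry_mul (hρ y).unitary, Finset.mul_sum]
    refine Finset.sum_le_sum fun a _ => ?_
    rw [← mul_one (lam * r y a), ← sum_norm_sq_row (hK y) a, Finset.mul_sum]
    refine Finset.sum_le_sum fun b _ => ?_
    simp only [G, Matrix.of_apply]
    have := hr y a
    split_ifs with h
    · rw [norm_zero, zero_pow two_ne_zero]; positivity
    · rw [norm_div, norm_mul, div_pow, mul_pow, Complex.norm_real, Complex.norm_real,
        Real.norm_eq_abs, Real.norm_eq_abs, sq_abs, sq_abs, Real.sq_sqrt (hs b)]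
      push Not at h
      rcases (hs b).eq_or_lt with h0 | h0
      · rw [← h0, div_zero]; positivity
      · rw [div_le_iff₀ h0]
        have h3 : r y a * r y a ≤ r y a * (lam * s b) := by gcongr
        nlinarith [sq_nonneg ‖K y a b‖]
  have hr' : ∀ y, 0 ≤ ∑ a, r y a := fun y => Finset.sum_nonneg fun a _ => hr y a
  have hs' : 0 ≤ ∑ b, s b := Finset.sum_nonneg fun b _ => hs b
  simp only [htr, Complex.add_re, mul_add, Finset.sum_add_distrib]
  refine add_le_add
    ((sum_re_trace_hashDeviation_le h2 syn hW (Ds * Vᴴ) fun y => U y * G y).trans ?_)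
    ((sum_re_trace_hashDeviation_le' syn hW (fun y => B y * Vᴴ) fun y => U y * Dr y).trans ?_)
  · refine mul_le_mul_of_nonneg_left (Real.sqrt_le_sqrt ?_) (Nat.cast_nonneg _)
    rw [hDsV]
    calc _ ≤ 2 * Fintype.card S * Fintype.card C * (∑ b, s b) *
          ∑ y, lam * ∑ a, r y a :=
          mul_le_mul_of_nonneg_left (Finset.sum_le_sum fun y _ => hG y) (by positivity)
      _ = _ := by
          rw [← Finset.mul_sum]
          ring
  · simp only [hDr, hBV]
    rw [Real.sqrt_mul (Finset.sum_nonneg fun y _ => hr' y)]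
    refine mul_le_mul_of_nonneg_left (mul_le_mul_of_nonneg_left ?_ zero_le_two)
      (Nat.cast_nonneg _)
    simp only [mul_comm (√(spectralTail _ _ _ _))]
    exact Real.sum_sqrt_mul_sqrt_le _ hr' fun y => spectralTail_nonneg (hr y) _

end LeftoverHash

/-! ## Moments of the likelihood ratio and entropy -/

/-- The second-order remainder `w² exp (κ |w|)` is absorbed by `exp |w|`, as `κ` is far below 1. The
error is expressed through `exp w` and `exp (-w)` because, for `w` a log-likelihood ratio, both have
bounded mean. -/
theorem exp_mul_le_quadratic {κ : ℝ} (hκ : 0 ≤ κ) (hκ' : κ ≤ 1 / 32) (w : ℝ) :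
    Real.exp (κ * w) ≤ 1 + κ * w + 3 * κ ^ 2 * (Real.exp w + Real.exp (-w)) := by
  have h1 : ∀ u : ℝ, 0 ≤ u → Real.exp u ≤ 1 + u + u ^ 2 * Real.exp u := by
    intro u hu
    have h2 : (1 - u) * Real.exp u ≤ 1 := by
      have h := Real.one_sub_le_exp_neg u
      calc (1 - u) * Real.exp u ≤ Real.exp (-u) * Real.exp u := by gcongr
        _ = 1 := by rw [← Real.exp_add]; simp
    nlinarith
  have h2 : ∀ w : ℝ, 0 ≤ w → w ^ 2 * Real.exp (κ * w) ≤ 3 * Real.exp w := by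
    intro w hw
    have e1 : Real.exp w = Real.exp (κ * w) * Real.exp ((1 - κ) * w) := by
      rw [← Real.exp_add]; ring_nf
    have e2 : Real.exp (31 / 32 * w) ≤ Real.exp ((1 - κ) * w) := by
      apply Real.exp_le_exp.mpr
      nlinarith
    have e3 := Real.quadratic_le_exp_of_nonneg (x := 31 / 32 * w) (by positivity)
    rw [e1]
    have := Real.exp_pos (κ * w)
    -- Here `exp u ≥ 1 + u + u²/2` at `u = 31 w / 32`, and `3 (31/32)² / 2 > 1`.
    have e4 : w ^ 2 ≤ 3 * Real.exp ((1 - κ) * w) := by nlinarith [sq_nonneg w]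
    nlinarith
  rcases le_total 0 w with hw | hw
  · have a1 := h1 (κ * w) (by positivity)
    have a2 := h2 w hw
    have a3 := Real.exp_pos (-w)
    have a4 : κ ^ 2 * (w ^ 2 * Real.exp (κ * w)) ≤ κ ^ 2 * (3 * Real.exp w) := by gcongr
    nlinarith [mul_nonneg (sq_nonneg κ) a3.le]
  · have hu : 0 ≤ -(κ * w) := by nlinarith
    have b1 : Real.exp (κ * w) ≤ 1 + κ * w + (κ * w) ^ 2 := by
      have h := Real.add_one_le_exp (-(κ * w))
      have hpos : 0 < 1 - κ * w := by linarith
      have h5 : Real.exp (κ * w) * (1 - κ * w) ≤ 1 := by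
        calc Real.exp (κ * w) * (1 - κ * w) ≤ Real.exp (κ * w) * Real.exp (-(κ * w)) := by
              gcongr; linarith
          _ = 1 := by rw [← Real.exp_add]; simp
      by_contra hc
      push Not at hc
      nlinarith [mul_lt_mul_of_pos_right hc hpos, mul_nonneg hu (sq_nonneg (κ * w))]
    have b2 := h2 (-w) (by linarith)
    have b3 : 1 ≤ Real.exp (κ * -w) := Real.one_le_exp (by linarith)
    have b4 : κ ^ 2 * w ^ 2 ≤ κ ^ 2 * (3 * Real.exp (-w)) := by
      gcongr
      nlinarith [sq_nonneg w]
    nlinarith [mul_nonneg (sq_nonneg κ) (Real.exp_pos w).le]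

section Overlap

variable {X d : Type*} [Fintype X] [Fintype d] [DecidableEq d]

/-- The entropy `H(X | E)` of a family of unnormalised states. -/
def blockEntropy (ρ : X → Matrix d d ℂ) : ℝ :=
  ∑ x, vonNeumannEntropy (ρ x) - vonNeumannEntropy (∑ x, ρ x)

/-- The moment of order `κ` of the ratio of the eigenvalues `r` and `s`, under the weights
given by `r` and the squared overlaps of the eigenbases. -/
def overlapMoment (κ : ℝ) (r s : d → ℝ) (K : Matrix d d ℂ) : ℝ :=
  ∑ a, ∑ b, r a * ‖K a b‖ ^ 2 * (r a / s b) ^ κ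

/-- Spectral data of a family of positive operators and of its sum. -/
structure IsJointDiagonalization (ρ U : X → Matrix d d ℂ) (r : X → d → ℝ) (V : Matrix d d ℂ)
    (s : d → ℝ) : Prop where
  diag : ∀ x, IsDiagonalization (ρ x) (U x) (r x)
  nonneg : ∀ x a, 0 ≤ r x a
  diag_sum : IsDiagonalization (∑ x, ρ x) V s
  nonneg_sum : ∀ b, 0 ≤ s b

namespace IsJointDiagonalization

variable {ρ U : X → Matrix d d ℂ} {r : X → d → ℝ} {V : Matrix d d ℂ} {s : d → ℝ}

theorem exists_of_posSemidef (hρ : ∀ x, (ρ x).PosSemidef) :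
    ∃ U r V s, IsJointDiagonalization ρ U r V s := by
  choose U r h h0 using fun x => IsDiagonalization.exists_of_posSemidef (hρ x)
  obtain ⟨V, s, hV, hs⟩ := IsDiagonalization.exists_of_posSemidef
    (Matrix.posSemidef_sum Finset.univ fun x _ => hρ x)
  exact ⟨U, r, V, s, h, h0, hV, hs⟩

variable (h : IsJointDiagonalization ρ U r V s)
include h

theorem overlap_unitary (x : X) : ((U x)ᴴ * V) * ((U x)ᴴ * V)ᴴ = 1 := by
  rw [Matrix.conjTranspose_mul, Matrix.conjTranspose_conjTranspose, Matrix.mul_assoc,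
    ← Matrix.mul_assoc V, h.diag_sum.unitary', Matrix.one_mul, (h.diag x).unitary]

theorem sum_row (x : X) (a : d) : ∑ b, ‖((U x)ᴴ * V) a b‖ ^ 2 = 1 :=
  sum_norm_sq_row (h.overlap_unitary x) a

theorem sum_col (x : X) (b : d) : ∑ a, ‖((U x)ᴴ * V) a b‖ ^ 2 = 1 := by
  have := sum_norm_sq_row (K := ((U x)ᴴ * V)ᴴ)
    (by rw [Matrix.conjTranspose_conjTranspose]; exact mul_eq_one_comm.mp (h.overlap_unitary x)) b
  simpa using this

/-- Both sides evaluate `V† (∑ ρ x) V` at `u`: once with the sum diagonalised, once term by term. -/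
theorem quadratic_form (u : d → ℂ) :
    ∑ b, s b * ‖u b‖ ^ 2 = ∑ x, ∑ a, r x a * ‖(((U x)ᴴ * V) *ᵥ u) a‖ ^ 2 := by
  have key : ∀ (A : Matrix d d ℂ) (c : d → ℝ),
      (star u ⬝ᵥ ((Aᴴ * Matrix.diagonal (fun i => (c i : ℂ)) * A) *ᵥ u)).re =
        ∑ a, c a * ‖(A *ᵥ u) a‖ ^ 2 := by
    intro A c
    rw [← Matrix.mulVec_mulVec, ← Matrix.mulVec_mulVec, Matrix.dotProduct_mulVec,
      ← Matrix.star_mulVec, dotProduct, Complex.re_sum]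
    refine Finset.sum_congr rfl fun a _ => ?_
    rw [Matrix.mulVec_diagonal, Pi.star_apply, mul_left_comm, Complex.star_def,
      ← Complex.normSq_eq_conj_mul_self, ← Complex.ofReal_mul, Complex.ofReal_re,
      Complex.normSq_eq_norm_sq]
  have e1 : Vᴴ * (∑ x, ρ x) * V = (1 : Matrix d d ℂ)ᴴ * Matrix.diagonal (fun i => (s i : ℂ)) *
      1 := by
    rw [h.diag_sum.eq, Matrix.conjTranspose_one, Matrix.one_mul, Matrix.mul_one]
    calc _ = (Vᴴ * V) * Matrix.diagonal (fun i => (s i : ℂ)) * (Vᴴ * V) := by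
          simp only [Matrix.mul_assoc]
      _ = _ := by rw [h.diag_sum.unitary, Matrix.one_mul, Matrix.mul_one]
  have e2 : Vᴴ * (∑ x, ρ x) * V = ∑ x, ((U x)ᴴ * V)ᴴ *
      Matrix.diagonal (fun i => (r x i : ℂ)) * ((U x)ᴴ * V) := by
    rw [Matrix.mul_sum, Matrix.sum_mul]
    refine Finset.sum_congr rfl fun x _ => ?_
    rw [(h.diag x).eq, Matrix.conjTranspose_mul, Matrix.conjTranspose_conjTranspose]
    simp only [Matrix.mul_assoc]
  have e3 := key 1 s
  rw [← e1, e2, Matrix.sum_mulVec, dotProduct_sum, Complex.re_sum] at e3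
  simp only [key, Matrix.one_mulVec] at e3
  exact e3.symm

/-- The quadratic form at a basis vector. Together with `sum_row`, this makes `r x a * ‖K a b‖²` a
joint distribution of two commuting variables, although the operators need not commute. -/
theorem sum_weights (b : d) : ∑ x, ∑ a, r x a * ‖((U x)ᴴ * V) a b‖ ^ 2 = s b := by
  have := h.quadratic_form (Pi.single b 1)
  rw [Finset.sum_eq_single b] at this
  · rw [Pi.single_eq_same, norm_one, one_pow, mul_one] at this
    rw [this]
    simp
  · intro b' _ hb
    simp [Pi.single_eq_of_ne hb]
  · simp

theorem weight_eq_zero {b : d} (hb : s b = 0) (x : X) (a : d) :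
    r x a * ‖((U x)ᴴ * V) a b‖ ^ 2 = 0 := by
  have hn : ∀ x a, 0 ≤ r x a * ‖((U x)ᴴ * V) a b‖ ^ 2 := fun x a =>
    mul_nonneg (h.nonneg x a) (by positivity)
  have := h.sum_weights b
  rw [hb, Finset.sum_eq_zero_iff_of_nonneg fun x _ => Finset.sum_nonneg fun a _ => hn x a]
    at this
  exact (Finset.sum_eq_zero_iff_of_nonneg fun a _ => hn x a).mp
    (this x (Finset.mem_univ _)) a (Finset.mem_univ _)

theorem sum_eigenvalues : ∑ x, ∑ a, r x a = ∑ b, s b := by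
  simp only [← h.sum_weights]
  symm
  calc _ = ∑ x, ∑ b, ∑ a, r x a * ‖((U x)ᴴ * V) a b‖ ^ 2 := Finset.sum_comm
    _ = ∑ x, ∑ a, ∑ b, r x a * ‖((U x)ᴴ * V) a b‖ ^ 2 :=
        Finset.sum_congr rfl fun x _ => Finset.sum_comm
    _ = _ := by simp only [← Finset.mul_sum, h.sum_row, mul_one]

/-- If `|a⟩` is the eigenvector of `ρ x` for `r x a` and `σ` is the sum, then `r x a |a⟩⟨a| ≤ σ`.
Evaluating this at `σ⁻¹|a⟩` gives `r q² ≤ q` for `q = ⟨a|σ⁻¹|a⟩`; inverses of zero eigenvalues are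
zero. -/
theorem sum_inv_le (x : X) (a : d) :
    r x a * ∑ b, ‖((U x)ᴴ * V) a b‖ ^ 2 / s b ≤ 1 := by
  set N : d → ℝ := fun b => ‖((U x)ᴴ * V) a b‖ ^ 2
  set q := ∑ b, N b / s b with hq
  have hN : ∀ b, 0 ≤ N b := fun b => sq_nonneg _
  have hq0 : 0 ≤ q := Finset.sum_nonneg fun b _ => div_nonneg (hN b) (h.nonneg_sum b)
  have h1 := h.quadratic_form fun b => star (((U x)ᴴ * V) a b) * ((s b)⁻¹ : ℝ)
  have h2 : ∑ b, s b * ‖star (((U x)ᴴ * V) a b) * ((s b)⁻¹ : ℝ)‖ ^ 2 = q := by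
    refine Finset.sum_congr rfl fun b _ => ?_
    rw [norm_mul, norm_star, mul_pow, Complex.norm_real, Real.norm_eq_abs, sq_abs]
    rcases (h.nonneg_sum b).eq_or_lt with h0 | h0
    · simp [← h0]
    · simp only [N]
      field_simp
  have h3 : (((U x)ᴴ * V) *ᵥ fun b => star (((U x)ᴴ * V) a b) * ((s b)⁻¹ : ℝ)) a = (q : ℂ) := by
    rw [Matrix.mulVec, dotProduct, hq, Complex.ofReal_sum]
    refine Finset.sum_congr rfl fun b _ => ?_
    rw [← mul_assoc, Complex.star_def, Complex.mul_conj, Complex.normSq_eq_norm_sq,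
      ← Complex.ofReal_mul, div_eq_mul_inv]
  rw [h2] at h1
  have h4 : r x a * q ^ 2 ≤ q := by
    conv_rhs => rw [h1]
    set T : X → d → ℝ := fun x' a' => r x' a' * ‖(((U x')ᴴ * V) *ᵥ fun b =>
      star (((U x)ᴴ * V) a b) * ((s b)⁻¹ : ℝ)) a'‖ ^ 2
    have hT : ∀ x' a', 0 ≤ T x' a' := fun x' a' => mul_nonneg (h.nonneg _ _) (sq_nonneg _)
    calc r x a * q ^ 2 = T x a := by
          simp only [T]
          rw [h3, Complex.norm_real, Real.norm_eq_abs, sq_abs]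
      _ ≤ ∑ a', T x a' := Finset.single_le_sum (fun a' _ => hT x a') (Finset.mem_univ a)
      _ ≤ ∑ x', ∑ a', T x' a' := Finset.single_le_sum (f := fun x' => ∑ a', T x' a')
          (fun x' _ => Finset.sum_nonneg fun a' _ => hT x' a') (Finset.mem_univ x)
  rcases hq0.eq_or_lt with h0 | h0
  · rw [← h0]; simp
  · nlinarith

/-- The entropies of the parts and of the sum are means of `-log r` and `-log s` under the two
marginals of the same distribution. -/
theorem blockEntropy_eq : Real.log 2 * blockEntropy ρ =
    ∑ x, ∑ a, ∑ b, r x a * ‖((U x)ᴴ * V) a b‖ ^ 2 * (Real.log (s b) - Real.log (r x a)) := by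
  have hl : Real.log 2 ≠ 0 := (Real.log_pos one_lt_two).ne'
  have e1 : ∑ x, ∑ a, ∑ b, r x a * ‖((U x)ᴴ * V) a b‖ ^ 2 * Real.log (s b) =
      ∑ b, s b * Real.log (s b) := by
    calc _ = ∑ x, ∑ b, ∑ a, r x a * ‖((U x)ᴴ * V) a b‖ ^ 2 * Real.log (s b) :=
          Finset.sum_congr rfl fun x _ => Finset.sum_comm
      _ = ∑ b, ∑ x, ∑ a, r x a * ‖((U x)ᴴ * V) a b‖ ^ 2 * Real.log (s b) := Finset.sum_comm
      _ = _ := by simp only [← Finset.sum_mul, h.sum_weights]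
  have e2 : ∑ x, ∑ a, ∑ b, r x a * ‖((U x)ᴴ * V) a b‖ ^ 2 * Real.log (r x a) =
      ∑ x, ∑ a, r x a * Real.log (r x a) := by
    simp only [← Finset.sum_mul, ← Finset.mul_sum, h.sum_row, mul_one]
  simp only [mul_sub, Finset.sum_sub_distrib, e1, e2, blockEntropy,
    h.diag_sum.vonNeumannEntropy_eq, (h.diag _).vonNeumannEntropy_eq, Finset.sum_neg_distrib,
    Real.logb, mul_div_assoc', ← Finset.sum_div]
  field_simp
  ring

/-- `exp` of the log-likelihood ratio has expectation at most `|X|`. -/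
theorem sum_ratio_le : ∑ x, ∑ a, ∑ b, r x a * ‖((U x)ᴴ * V) a b‖ ^ 2 * (s b / r x a) ≤
    Fintype.card X * ∑ b, s b := by
  calc _ ≤ ∑ x, ∑ a, ∑ b, ‖((U x)ᴴ * V) a b‖ ^ 2 * s b := by
        refine Finset.sum_le_sum fun x _ => Finset.sum_le_sum fun a _ =>
          Finset.sum_le_sum fun b _ => ?_
        rcases (h.nonneg x a).eq_or_lt with h0 | h0
        · rw [← h0, zero_mul, zero_mul]
          exact mul_nonneg (by positivity) (h.nonneg_sum b)
        · apply le_of_eq; field_simp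
    _ = ∑ _x : X, ∑ b, s b := by
        refine Finset.sum_congr rfl fun x _ => ?_
        rw [Finset.sum_comm]
        simp only [← Finset.sum_mul, h.sum_col, one_mul]
    _ = _ := by simp

/-- The pointwise inequality `r ≤ s` can fail for operators that do not commute; what survives is
the mean over `b` supplied by `sum_inv_le`. -/
theorem sum_inv_ratio_le : ∑ x, ∑ a, ∑ b, r x a * ‖((U x)ᴴ * V) a b‖ ^ 2 * (r x a / s b) ≤
    ∑ b, s b := by
  rw [← h.sum_eigenvalues]
  refine Finset.sum_le_sum fun x _ => Finset.sum_le_sum fun a _ => ?_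
  calc _ = r x a * (r x a * ∑ b, ‖((U x)ᴴ * V) a b‖ ^ 2 / s b) := by
        simp only [Finset.mul_sum]
        exact Finset.sum_congr rfl fun b _ => by ring
    _ ≤ r x a * 1 := mul_le_mul_of_nonneg_left (h.sum_inv_le x a) (h.nonneg x a)
    _ = _ := mul_one _

theorem sum_all_weights : ∑ x, ∑ a, ∑ b, r x a * ‖((U x)ᴴ * V) a b‖ ^ 2 = ∑ b, s b := by
  rw [← h.sum_eigenvalues]
  simp only [← Finset.mul_sum, h.sum_row, mul_one]

/-- `exp_mul_le_quadratic` at `w = log (r / s)`: the linear term has mean minus the entropy, and the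
means of `exp (-w)` and `exp w` give the `|X|` and the `1` in the error. -/
theorem overlapMoment_le {κ : ℝ} (hκ : 0 ≤ κ) (hκ' : κ ≤ 1 / 32) :
    ∑ x, overlapMoment κ (r x) s ((U x)ᴴ * V) ≤
      (1 + 3 * κ ^ 2 * (Fintype.card X + 1)) * ∑ b, s b - κ * (Real.log 2 * blockEntropy ρ) := by
  have hp : ∀ x a b, r x a * ‖((U x)ᴴ * V) a b‖ ^ 2 * (r x a / s b) ^ κ ≤
      r x a * ‖((U x)ᴴ * V) a b‖ ^ 2 -
      κ * (r x a * ‖((U x)ᴴ * V) a b‖ ^ 2 * (Real.log (s b) - Real.log (r x a))) +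
      3 * κ ^ 2 * (r x a * ‖((U x)ᴴ * V) a b‖ ^ 2 * (s b / r x a) +
        r x a * ‖((U x)ᴴ * V) a b‖ ^ 2 * (r x a / s b)) := by
    intro x a b
    rcases (h.nonneg x a).eq_or_lt with h0 | h0
    · simp [← h0]
    rcases (h.nonneg_sum b).eq_or_lt with h1 | h1
    · rw [h.weight_eq_zero h1.symm]; simp
    have hw : 0 ≤ r x a * ‖((U x)ᴴ * V) a b‖ ^ 2 := by positivity
    have e := exp_mul_le_quadratic hκ hκ' (Real.log (r x a) - Real.log (s b))
    rw [neg_sub, ← Real.log_div h0.ne' h1.ne', ← Real.log_div h1.ne' h0.ne',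
      Real.exp_log (by positivity), Real.exp_log (by positivity), mul_comm κ,
      ← Real.rpow_def_of_pos (by positivity), Real.log_div h0.ne' h1.ne'] at e
    have := mul_le_mul_of_nonneg_left e hw
    refine this.trans (le_of_eq ?_)
    ring
  calc _ ≤ ∑ x, ∑ a, ∑ b, (r x a * ‖((U x)ᴴ * V) a b‖ ^ 2 -
      κ * (r x a * ‖((U x)ᴴ * V) a b‖ ^ 2 * (Real.log (s b) - Real.log (r x a))) +
      3 * κ ^ 2 * (r x a * ‖((U x)ᴴ * V) a b‖ ^ 2 * (s b / r x a) +
        r x a * ‖((U x)ᴴ * V) a b‖ ^ 2 * (r x a / s b))) :=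
        Finset.sum_le_sum fun x _ => Finset.sum_le_sum fun a _ => Finset.sum_le_sum fun b _ =>
          hp x a b
    _ = ∑ b, s b - κ * (Real.log 2 * blockEntropy ρ) + 3 * κ ^ 2 *
        (∑ x, ∑ a, ∑ b, r x a * ‖((U x)ᴴ * V) a b‖ ^ 2 * (s b / r x a) +
        ∑ x, ∑ a, ∑ b, r x a * ‖((U x)ᴴ * V) a b‖ ^ 2 * (r x a / s b)) := by
        simp only [Finset.sum_add_distrib, Finset.sum_sub_distrib, ← Finset.mul_sum,
          h.blockEntropy_eq]
        simp only [← h.sum_all_weights, ← Finset.mul_sum]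
    _ ≤ ∑ b, s b - κ * (Real.log 2 * blockEntropy ρ) + 3 * κ ^ 2 *
        (Fintype.card X * ∑ b, s b + ∑ b, s b) := by
        gcongr
        · exact h.sum_ratio_le
        · exact h.sum_inv_ratio_le
    _ = _ := by ring

/-- Jensen's inequality, in the form `log u ≤ u - 1` at `u = s / (r |X|)`. -/
theorem blockEntropy_le [Nonempty X] :
    Real.log 2 * blockEntropy ρ ≤ Real.log (Fintype.card X) * ∑ b, s b := by
  have hX : (0 : ℝ) < Fintype.card X := by exact_mod_cast Fintype.card_pos
  rw [h.blockEntropy_eq]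
  calc _ ≤ ∑ x, ∑ a, ∑ b, (r x a * ‖((U x)ᴴ * V) a b‖ ^ 2 * (s b / r x a) *
        (Fintype.card X : ℝ)⁻¹ + (Real.log (Fintype.card X) - 1) *
          (r x a * ‖((U x)ᴴ * V) a b‖ ^ 2)) := by
        refine Finset.sum_le_sum fun x _ => Finset.sum_le_sum fun a _ =>
          Finset.sum_le_sum fun b _ => ?_
        rcases (h.nonneg x a).eq_or_lt with h0 | h0
        · simp [← h0]
        rcases (h.nonneg_sum b).eq_or_lt with h1 | h1
        · rw [h.weight_eq_zero h1.symm]; simp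
        have hw : 0 ≤ r x a * ‖((U x)ᴴ * V) a b‖ ^ 2 := by positivity
        have e := Real.log_le_sub_one_of_pos
          (show 0 < s b / r x a * (Fintype.card X : ℝ)⁻¹ by positivity)
        rw [Real.log_mul (by positivity) (by positivity), Real.log_inv,
          Real.log_div h1.ne' h0.ne'] at e
        nlinarith
    _ = (∑ x, ∑ a, ∑ b, r x a * ‖((U x)ᴴ * V) a b‖ ^ 2 * (s b / r x a)) *
        (Fintype.card X : ℝ)⁻¹ + (Real.log (Fintype.card X) - 1) * ∑ b, s b := by
        simp only [Finset.sum_add_distrib, ← Finset.mul_sum, ← Finset.sum_mul]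
        simp only [← h.sum_all_weights, ← Finset.mul_sum]
    _ ≤ (Fintype.card X * ∑ b, s b) * (Fintype.card X : ℝ)⁻¹ +
        (Real.log (Fintype.card X) - 1) * ∑ b, s b := by
        gcongr
        exact h.sum_ratio_le
    _ = _ := by field_simp; ring

end IsJointDiagonalization

end Overlap

/-! ## One round -/

section BlockEntropy

variable {X C d : Type*} [Fintype X] [Fintype C] [Fintype d] [DecidableEq d]

theorem vonNeumannEntropy_smul {A U : Matrix d d ℂ} {a : d → ℝ} (h : IsDiagonalization A U a)
    (c : ℝ) : vonNeumannEntropy ((c : ℂ) • A) =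
      c * vonNeumannEntropy A - c * Real.logb 2 c * ∑ i, a i := by
  rw [(h.smul c).vonNeumannEntropy_eq, h.vonNeumannEntropy_eq, Finset.mul_sum, Finset.mul_sum,
    ← Finset.sum_sub_distrib]
  refine Finset.sum_congr rfl fun i _ => ?_
  rcases eq_or_ne c 0 with hc | hc
  · simp [hc]
  rcases eq_or_ne (a i) 0 with ha | ha
  · simp [ha]
  · rw [Real.logb_mul hc ha]; ring

/-- The terms with `logb 2 c` cancel because the parts and their sum have the same total trace. -/
theorem blockEntropy_smul {ρ : X → Matrix d d ℂ} (hρ : ∀ x, (ρ x).PosSemidef) (c : ℝ) :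
    blockEntropy (fun x => (c : ℂ) • ρ x) = c * blockEntropy ρ := by
  obtain ⟨U, r, V, s, h⟩ := IsJointDiagonalization.exists_of_posSemidef hρ
  simp only [blockEntropy, ← Finset.smul_sum, vonNeumannEntropy_smul (h.diag _),
    vonNeumannEntropy_smul h.diag_sum, Finset.sum_sub_distrib, ← Finset.mul_sum,
    h.sum_eigenvalues]
  ring

theorem blockEntropy_comp_equiv (ρ : X → Matrix d d ℂ) (e : X ≃ X) :
    blockEntropy (fun x => ρ (e x)) = blockEntropy ρ := by
  simp only [blockEntropy, Equiv.sum_comp e (fun x => vonNeumannEntropy (ρ x)),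
    Equiv.sum_comp e ρ]

theorem vonNeumannEntropy_blockDiagonal [DecidableEq X] {ρ : X → Matrix d d ℂ}
    (hρ : ∀ x, (ρ x).PosSemidef) :
    vonNeumannEntropy (Matrix.blockDiagonal ρ) = ∑ x, vonNeumannEntropy (ρ x) := by
  choose U r h _ using fun x => IsDiagonalization.exists_of_posSemidef (hρ x)
  simp only [(IsDiagonalization.blockDiagonal h).vonNeumannEntropy_eq,
    (h _).vonNeumannEntropy_eq]
  rw [Fintype.sum_prod_type_right]

theorem condEntropy_eq_sum_blockEntropy [DecidableEq X] [DecidableEq C]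
    {ρ : X → C → Matrix d d ℂ} (hρ : ∀ x c, (ρ x c).PosSemidef) :
    condEntropy ρ = ∑ c, blockEntropy fun x => ρ x c := by
  rw [condEntropy, vonNeumannEntropy_blockDiagonal fun _ => hρ _ _,
    vonNeumannEntropy_blockDiagonal fun c => Matrix.posSemidef_sum _ fun x _ => hρ x c,
    Fintype.sum_prod_type_right]
  simp only [blockEntropy, Finset.sum_sub_distrib]

end BlockEntropy

/-! ### BB84 states and the Pauli twirl of a measurement operator -/

section Round

variable {d d' : ℕ}

theorem QuantumOperation.apply_posSemidef (N : QuantumOperation d d')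
    {ρ : Matrix (Fin d) (Fin d) ℂ} (hρ : ρ.PosSemidef) : (N.apply ρ).PosSemidef :=
  Matrix.posSemidef_sum _ fun _ _ => hρ.mul_mul_conjTranspose_same _

theorem QuantumOperation.apply_smul (N : QuantumOperation d d') (c : ℂ)
    (ρ : Matrix (Fin d) (Fin d) ℂ) : N.apply (c • ρ) = c • N.apply ρ := by
  simp [QuantumOperation.apply, Finset.smul_sum]

theorem QuantumOperation.trace_apply (N : QuantumOperation d d')
    (ρ : Matrix (Fin d) (Fin d) ℂ) : (N.apply ρ).trace = ρ.trace := by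
  calc (N.apply ρ).trace = ∑ a, Matrix.trace ((N.kraus a)ᴴ * N.kraus a * ρ) := by
        rw [QuantumOperation.apply, Matrix.trace_sum]
        refine Finset.sum_congr rfl fun a _ => ?_
        rw [Matrix.trace_mul_comm, ← Matrix.mul_assoc]
    _ = ρ.trace := by
        rw [← Matrix.trace_sum, ← Matrix.sum_mul, N.complete, Matrix.one_mul]

theorem bb84_posSemidef (x : ZMod 2) (θ : Bool) : (bb84 x θ).PosSemidef :=
  Matrix.posSemidef_vecMulVec_self_star _

theorem zmod_two_cases (x : ZMod 2) : x = 0 ∨ x = 1 := by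
  revert x; decide

theorem inv_sqrt_two_mul_self : ((√2 : ℂ))⁻¹ * (√2 : ℂ)⁻¹ = 1 / 2 := by
  rw [← mul_inv, ← Complex.ofReal_mul, Real.mul_self_sqrt zero_le_two]
  norm_num

theorem bb84_false (x : ZMod 2) :
    bb84 x false = if x = 0 then !![1, 0; 0, 0] else !![0, 0; 0, 1] := by
  rcases zmod_two_cases x with rfl | rfl <;> ext i j <;> fin_cases i <;> fin_cases j <;>
    simp [bb84, bb84Ket, Matrix.vecMulVec_apply]

theorem bb84_true (x : ZMod 2) :
    bb84 x true = if x = 0 then !![1 / 2, 1 / 2; 1 / 2, 1 / 2]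
      else !![1 / 2, -(1 / 2); -(1 / 2), 1 / 2] := by
  have := inv_sqrt_two_mul_self
  rcases zmod_two_cases x with rfl | rfl <;> ext i j <;> fin_cases i <;> fin_cases j <;>
    simp [bb84, bb84Ket, Matrix.vecMulVec_apply, div_eq_mul_inv, this]

theorem sum_bb84 (θ : Bool) : ∑ x, bb84 x θ = 1 := by
  have : (Finset.univ : Finset (ZMod 2)) = {0, 1} := rfl
  rw [this, Finset.sum_pair zero_ne_one]
  cases θ
  · rw [bb84_false, bb84_false]
    ext i j
    fin_cases i <;> fin_cases j <;> simp
  · rw [bb84_true, bb84_true]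
    ext i j
    fin_cases i <;> fin_cases j <;> norm_num

/-- The Pauli operators `id`, `X`, `Z` and `X Z`. -/
def pauli : Fin 4 → Matrix (Fin 2) (Fin 2) ℂ :=
  ![1, !![0, 1; 1, 0], !![1, 0; 0, -1], !![0, -1; 1, 0]]

/-- The action of the Pauli operators on the bits encoded in the basis `θ`. -/
def pauliFlip (θ : Bool) : Fin 4 → ZMod 2 :=
  ![0, if θ then 0 else 1, if θ then 1 else 0, 1]

theorem pauli_mul_bb84 (j : Fin 4) (x : ZMod 2) (θ : Bool) :
    pauli j * bb84 x θ * (pauli j)ᴴ = bb84 (x + pauliFlip θ j) θ := by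
  have h11 : (1 : ZMod 2) + 1 = 0 := rfl
  cases θ <;> simp only [bb84_false, bb84_true] <;>
  rcases zmod_two_cases x with rfl | rfl <;> fin_cases j <;> ext a b <;>
    fin_cases a <;> fin_cases b <;>
    simp [pauli, pauliFlip, h11, Matrix.mul_apply, Fin.sum_univ_two]

theorem pauli_twirl (A : Matrix (Fin 2) (Fin 2) ℂ) :
    ∑ j, (pauli j)ᴴ * A * pauli j = (2 * A.trace) • (1 : Matrix (Fin 2) (Fin 2) ℂ) := by
  ext a b
  fin_cases a <;> fin_cases b <;>
    simp [pauli, Fin.sum_univ_four, Matrix.trace_fin_two, Matrix.mul_apply,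
      Fin.sum_univ_two] <;> ring

namespace PartialMeasurement

/-- Twice the probability of the outcome `k` on a uniformly random BB84 state. -/
def weight (P : PartialMeasurement d) (k : Fin P.outcomes) : ℝ :=
  ((P.op k)ᴴ * P.op k).trace.re

theorem ofReal_weight (P : PartialMeasurement d) (k : Fin P.outcomes) :
    (P.weight k : ℂ) = ((P.op k)ᴴ * P.op k).trace := by
  have h := (Matrix.posSemidef_conjTranspose_mul_self (P.op k)).trace_nonneg
  exact Complex.ext rfl (Complex.nonneg_iff.mp h).2

theorem weight_nonneg (P : PartialMeasurement d) (k : Fin P.outcomes) : 0 ≤ P.weight k := by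
  rw [weight, ← frobSq_eq_trace]
  exact frobSq_nonneg _

theorem sum_weight (P : PartialMeasurement d) : ∑ k, P.weight k = 2 := by
  simp only [weight, ← Complex.re_sum, ← Matrix.trace_sum, P.complete]
  simp

variable (P : PartialMeasurement d) (N : QuantumOperation d d')

theorem storedState_posSemidef (k : Fin P.outcomes) (x : ZMod 2) (θ : Bool) :
    (storedState P N k x θ).PosSemidef :=
  N.apply_posSemidef ((bb84_posSemidef x θ).mul_mul_conjTranspose_same _)

/-- In either basis the two BB84 states sum to the identity, and the storage noise preserves the
trace. The value is the same for both `θ`, so an outcome carries no information about the basis. -/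
theorem trace_sum_storedState (k : Fin P.outcomes) (θ : Bool) :
    (∑ x, storedState P N k x θ).trace = P.weight k := by
  rw [Matrix.trace_sum]
  simp only [storedState, N.trace_apply, post]
  rw [← Matrix.trace_sum, ← Matrix.sum_mul, ← Matrix.mul_sum, sum_bb84, Matrix.mul_one,
    Matrix.trace_mul_comm, ofReal_weight]

theorem roundEntropy_eq : roundEntropy P N =
    ∑ c : Bool × Fin P.outcomes, 1 / 4 * blockEntropy fun x => storedState P N c.2 x c.1 := by
  have h4 : (1 / 4 : ℂ) = ((1 / 4 : ℝ) : ℂ) := by norm_num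
  rw [roundEntropy, condEntropy_eq_sum_blockEntropy]
  · refine Finset.sum_congr rfl fun c _ => ?_
    rw [← blockEntropy_smul (fun x => storedState_posSemidef P N c.2 x c.1), h4]
  · intro x c
    exact (storedState_posSemidef P N c.2 x c.1).smul
      (by rw [h4]; exact_mod_cast (by norm_num : (0 : ℝ) ≤ 1 / 4))

/-- The partial measurement that applies a random Pauli operator followed by the operator of
the outcome `k`, suitably normalised. -/
def pauliTwirl (k : Fin P.outcomes) (hk : 0 < P.weight k) : PartialMeasurement d where
  outcomes := 4
  -- The four Pauli conjugates of `M†M` add up to twice its trace times the identity, which dictates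
  -- the normalisation.
  op j := ((√(2 * P.weight k))⁻¹ : ℝ) • (P.op k * pauli j)
  complete := by
    have h : (√(2 * P.weight k))⁻¹ * (√(2 * P.weight k))⁻¹ * (2 * P.weight k) = 1 := by
      rw [← mul_inv, Real.mul_self_sqrt (by positivity), inv_mul_cancel₀ (by positivity)]
    simp only [Matrix.conjTranspose_smul, Matrix.conjTranspose_mul, Matrix.smul_mul,
      Matrix.mul_smul, smul_smul, star_trivial, ← Finset.smul_sum]
    have e : ∑ j, (pauli j)ᴴ * (P.op k)ᴴ * (P.op k * pauli j) =
        (2 * P.weight k : ℝ) • (1 : Matrix (Fin 2) (Fin 2) ℂ) := by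
      have := pauli_twirl ((P.op k)ᴴ * P.op k)
      rw [← P.ofReal_weight] at this
      simp only [Matrix.mul_assoc] at this ⊢
      rw [this]
      ext a b
      simp
    rw [e, smul_smul, h, one_smul]

theorem storedState_pauliTwirl (k : Fin P.outcomes) (hk : 0 < P.weight k) (j : Fin 4)
    (x : ZMod 2) (θ : Bool) :
    storedState (P.pauliTwirl k hk) N j x θ =
      (((2 * P.weight k)⁻¹ : ℝ) : ℂ) • storedState P N k (x + pauliFlip θ j) θ := by
  have h : (√(2 * P.weight k))⁻¹ * (√(2 * P.weight k))⁻¹ = (2 * P.weight k)⁻¹ := by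
    rw [← mul_inv, Real.mul_self_sqrt (by positivity)]
  simp only [storedState, ← N.apply_smul, post]
  rw [← pauli_mul_bb84]
  congr 1
  simp only [pauliTwirl, Matrix.conjTranspose_smul, Matrix.conjTranspose_mul, Matrix.smul_mul,
    Matrix.mul_smul, smul_smul, star_trivial, h, Matrix.mul_assoc]
  ext a b
  simp

theorem blockEntropy_pauliTwirl (k : Fin P.outcomes) (hk : 0 < P.weight k)
    (j : Fin (P.pauliTwirl k hk).outcomes) (θ : Bool) :
    blockEntropy (fun x => storedState (P.pauliTwirl k hk) N j x θ) =
      (2 * P.weight k)⁻¹ * blockEntropy (fun x => storedState P N k x θ) := by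
  have h : (fun x => storedState (P.pauliTwirl k hk) N j x θ) = fun x =>
      (((2 * P.weight k)⁻¹ : ℝ) : ℂ) • storedState P N k (x + pauliFlip θ j) θ :=
    funext fun x => P.storedState_pauliTwirl N k hk j x θ
  have h' : blockEntropy (fun x => storedState P N k (x + pauliFlip θ j) θ) =
      blockEntropy (fun x => storedState P N k x θ) :=
    blockEntropy_comp_equiv (fun x => storedState P N k x θ) (Equiv.addRight (pauliFlip θ j))
  rw [h, blockEntropy_smul (fun x => storedState_posSemidef P N k (x + pauliFlip θ j) θ), h']

/-- A Pauli operator only permutes the two bits within each basis, so the four outcomes carry equal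
entropy. The twirled measurement thereby isolates the outcome `k` of `P`. -/
theorem roundEntropy_pauliTwirl (k : Fin P.outcomes) (hk : 0 < P.weight k) :
    roundEntropy (P.pauliTwirl k hk) N = (2 * P.weight k)⁻¹ *
      (blockEntropy (fun x => storedState P N k x false) +
        blockEntropy (fun x => storedState P N k x true)) := by
  rw [roundEntropy_eq, Fintype.sum_prod_type]
  simp only [blockEntropy_pauliTwirl, Finset.sum_const, Finset.card_univ, Fintype.card_fin,
    Fintype.sum_bool, nsmul_eq_mul]
  have : ((P.pauliTwirl k hk).outcomes : ℝ) = 4 := by norm_num [pauliTwirl]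
  rw [this]
  ring

/-- An uncertainty bound holds for every single outcome. -/
theorem blockEntropy_add_ge {t : ℝ} (ht : ∀ P : PartialMeasurement d, t ≤ roundEntropy P N)
    (k : Fin P.outcomes) :
    2 * P.weight k * t ≤ blockEntropy (fun x => storedState P N k x false) +
      blockEntropy (fun x => storedState P N k x true) := by
  rcases (P.weight_nonneg k).eq_or_lt with h0 | hk
  · have hz : ∀ θ, blockEntropy (fun x => storedState P N k x θ) = 0 := by
      intro θ
      have hop : P.op k = 0 := by
        rw [← Matrix.conjTranspose_mul_self_eq_zero,
          ← (Matrix.posSemidef_conjTranspose_mul_self _).trace_eq_zero_iff,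
          ← P.ofReal_weight, ← h0, Complex.ofReal_zero]
      have : (fun x => storedState P N k x θ) = fun x => ((0 : ℝ) : ℂ) • storedState P N k x θ := by
        funext x
        simp [storedState, post, hop, QuantumOperation.apply]
      rw [this, blockEntropy_smul fun x => storedState_posSemidef P N k x θ, zero_mul]
    rw [hz, hz, ← h0]
    simp
  · have h := ht (P.pauliTwirl k hk)
    rw [roundEntropy_pauliTwirl, ← div_eq_inv_mul, le_div_iff₀ (by positivity)] at h
    linarith

end PartialMeasurement

end Round

/-! ## Product states -/

section PiTensor

variable {n : ℕ} {d : Fin n → ℕ}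

theorem prod_sum_sum {α β : Fin n → Type*} [∀ i, Fintype (α i)] [∀ i, Fintype (β i)]
    (g : ∀ i, α i → β i → ℝ) :
    ∏ i, ∑ a, ∑ b, g i a b = ∑ e : ∀ i, α i, ∑ e' : ∀ i, β i, ∏ i, g i (e i) (e' i) := by
  classical
  rw [Fintype.prod_sum]
  exact Finset.sum_congr rfl fun e _ => Fintype.prod_sum _

theorem piTensor_mul (M M' : ∀ i, Matrix (Fin (d i)) (Fin (d i)) ℂ) :
    piTensor M * piTensor M' = piTensor fun i => M i * M' i := by
  ext e e'
  simp only [piTensor, Matrix.mul_apply, Matrix.of_apply, ← Finset.prod_mul_distrib]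
  rw [Fintype.prod_sum]

theorem piTensor_conjTranspose (M : ∀ i, Matrix (Fin (d i)) (Fin (d i)) ℂ) :
    (piTensor M)ᴴ = piTensor fun i => (M i)ᴴ := by
  ext e e'
  simp [piTensor, Matrix.conjTranspose_apply, star_prod]

theorem piTensor_diagonal (a : ∀ i, Fin (d i) → ℂ) :
    (piTensor fun i => Matrix.diagonal (a i)) = Matrix.diagonal fun e => ∏ i, a i (e i) := by
  ext e e'
  simp only [piTensor, Matrix.of_apply, Matrix.diagonal_apply]
  split_ifs with h
  · subst h; simp
  · obtain ⟨i, hi⟩ := Function.ne_iff.mp h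
    exact Finset.prod_eq_zero (Finset.mem_univ i) (if_neg hi)

theorem piTensor_one : (piTensor fun i => (1 : Matrix (Fin (d i)) (Fin (d i)) ℂ)) = 1 := by
  simp only [← Matrix.diagonal_one]
  rw [piTensor_diagonal]
  simp

theorem trace_piTensor (M : ∀ i, Matrix (Fin (d i)) (Fin (d i)) ℂ) :
    (piTensor M).trace = ∏ i, (M i).trace := by
  simp only [Matrix.trace, Matrix.diag, piTensor, Matrix.of_apply]
  rw [Fintype.prod_sum]

theorem IsDiagonalization.piTensor {A U : ∀ i, Matrix (Fin (d i)) (Fin (d i)) ℂ}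
    {a : ∀ i, Fin (d i) → ℝ} (h : ∀ i, IsDiagonalization (A i) (U i) (a i)) :
    IsDiagonalization (piTensor A) (piTensor U) fun e => ∏ i, a i (e i) := by
  constructor
  · rw [piTensor_conjTranspose, piTensor_mul]
    simp only [(h _).unitary, piTensor_one]
  · simp only [Complex.ofReal_prod]
    rw [piTensor_conjTranspose, ← piTensor_diagonal fun i j => (a i j : ℂ), piTensor_mul,
      piTensor_mul]
    congr 1
    exact funext fun i => (h i).eq

theorem posSemidef_piTensor {M : ∀ i, Matrix (Fin (d i)) (Fin (d i)) ℂ}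
    (hM : ∀ i, (M i).PosSemidef) : (piTensor M).PosSemidef := by
  have : ∀ i, ∃ B : Matrix (Fin (d i)) (Fin (d i)) ℂ, M i = Bᴴ * B := fun i => by
    open scoped MatrixOrder in
    exact CStarAlgebra.nonneg_iff_eq_star_mul_self.mp (hM i).nonneg
  choose B hB using this
  have e : piTensor M = (piTensor B)ᴴ * piTensor B := by
    rw [piTensor_conjTranspose, piTensor_mul]
    exact congrArg _ (funext hB)
  rw [e]
  exact Matrix.posSemidef_conjTranspose_mul_self _

/-- A Chernoff bound for the spectral tail of product operators. -/
theorem spectralTail_piTensor_le {r s : ∀ i, Fin (d i) → ℝ}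
    {K : ∀ i, Matrix (Fin (d i)) (Fin (d i)) ℂ} (hr : ∀ i a, 0 ≤ r i a)
    (hs : ∀ i b, 0 ≤ s i b) (h0 : ∀ i a b, s i b = 0 → r i a * ‖K i a b‖ ^ 2 = 0)
    {lam κ : ℝ} (hlam : 0 < lam) (hκ : 0 ≤ κ) :
    spectralTail lam (fun e => ∏ i, r i (e i)) (fun e => ∏ i, s i (e i)) (piTensor K) ≤
      lam ^ (-κ) * ∏ i, overlapMoment κ (r i) (s i) (K i) := by
  simp only [overlapMoment, spectralTail]
  rw [prod_sum_sum, Finset.mul_sum]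
  refine Finset.sum_le_sum fun e _ => ?_
  rw [Finset.mul_sum]
  refine Finset.sum_le_sum fun e' _ => ?_
  have hR : 0 ≤ ∏ i, r i (e i) := Finset.prod_nonneg fun i _ => hr i _
  have hS : 0 ≤ ∏ i, s i (e' i) := Finset.prod_nonneg fun i _ => hs i _
  have hw : (∏ i, r i (e i)) * ‖piTensor K e e'‖ ^ 2 =
      ∏ i, r i (e i) * ‖K i (e i) (e' i)‖ ^ 2 := by
    simp only [piTensor, Matrix.of_apply, norm_prod, Finset.prod_mul_distrib, Finset.prod_pow]
  have hwn : 0 ≤ ∏ i, r i (e i) * ‖K i (e i) (e' i)‖ ^ 2 :=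
    Finset.prod_nonneg fun i _ => mul_nonneg (hr i _) (sq_nonneg _)
  rw [Finset.prod_mul_distrib (f := fun i => r i (e i) * ‖K i (e i) (e' i)‖ ^ 2),
    Real.finsetProd_rpow _ _ fun i _ => div_nonneg (hr i _) (hs i _), Finset.prod_div_distrib]
  split_ifs with h
  · rw [hw]
    rcases hS.eq_or_lt with hS0 | hS0
    -- With a vanishing reference eigenvalue the ratio is 0 by convention and the bound on the right
    -- is useless; but then the weight vanishes too.
    · obtain ⟨i, -, hi⟩ := Finset.prod_eq_zero_iff.mp hS0.symm
      have : ∏ i, r i (e i) * ‖K i (e i) (e' i)‖ ^ 2 = 0 :=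
        Finset.prod_eq_zero (Finset.mem_univ i) (h0 i _ _ hi)
      rw [this]
      simp
    · have hle : lam ≤ (∏ i, r i (e i)) / ∏ i, s i (e' i) := by
        rw [le_div_iff₀ hS0]; exact h.le
      -- Markov's inequality for the power `κ` of the ratio.
      have h1 : 1 ≤ lam ^ (-κ) * ((∏ i, r i (e i)) / ∏ i, s i (e' i)) ^ κ := by
        rw [Real.rpow_neg hlam.le, inv_mul_eq_div, one_le_div (by positivity)]
        exact Real.rpow_le_rpow hlam.le hle hκ
      nlinarith
  · exact mul_nonneg (by positivity)
      (mul_nonneg hwn (Real.rpow_nonneg (div_nonneg hR hS) _))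

/-- At a position whose bit is known, the state serves as its own reference and the likelihood ratio
is 1. -/
theorem overlapMoment_self {d : ℕ} {U : Matrix (Fin d) (Fin d) ℂ} (hU : Uᴴ * U = 1)
    (κ : ℝ) (r : Fin d → ℝ) : overlapMoment κ r r (Uᴴ * U) = ∑ a, r a := by
  refine Finset.sum_congr rfl fun a _ => ?_
  rw [Finset.sum_eq_single a]
  · rw [hU, Matrix.one_apply_eq, norm_one, one_pow, mul_one]
    rcases eq_or_ne (r a) 0 with h | h
    · simp [h]
    · rw [div_self h, Real.one_rpow, mul_one]
  · intro b _ hb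
    rw [hU, Matrix.one_apply_ne hb.symm]
    simp
  · simp

end PiTensor

/-! ### Splitting a string at a set of positions -/

section Merge

variable {n : ℕ} (I : Finset (Fin n))

/-- The string that agrees with `y` on `I` and with `u` elsewhere. -/
def mergeBits (y : {i // i ∈ I} → ZMod 2) (u : BitString n) : BitString n :=
  fun i => if h : i ∈ I then y ⟨i, h⟩ else u i

variable {I}

theorem mergeBits_of_mem (y : {i // i ∈ I} → ZMod 2) (u : BitString n) {i : Fin n}
    (h : i ∈ I) : mergeBits I y u i = y ⟨i, h⟩ := dif_pos h

theorem mergeBits_of_notMem (y : {i // i ∈ I} → ZMod 2) (u : BitString n) {i : Fin n}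
    (h : i ∉ I) : mergeBits I y u i = u i := dif_neg h

theorem sum_prod_mergeBits (g : Fin n → ZMod 2 → ℝ) (u : BitString n) :
    ∑ y, ∏ i, g i (mergeBits I y u i) =
      (∏ i ∈ I, ∑ x, g i x) * ∏ i ∈ Iᶜ, g i (u i) := by
  have h : ∀ y : {i // i ∈ I} → ZMod 2, ∏ i, g i (mergeBits I y u i) =
      (∏ i : {i // i ∈ I}, g i (y i)) * ∏ i ∈ Iᶜ, g i (u i) := by
    intro y
    rw [← Finset.prod_mul_prod_compl I, ← Finset.prod_coe_sort I]
    congr 1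
    · exact Finset.prod_congr rfl fun i _ => by rw [mergeBits_of_mem y u i.2]
    · exact Finset.prod_congr rfl fun i hi => by
        rw [mergeBits_of_notMem y u (Finset.mem_compl.mp hi)]
  simp only [h, ← Finset.sum_mul]
  congr 1
  rw [← Finset.prod_coe_sort I, Fintype.prod_sum]

/-- Splitting a sum over all strings at a set of positions. -/
theorem sum_eq_sum_mergeBits (I : Finset (Fin n)) (G : BitString n → ℝ) :
    ∑ x, G x = ∑ u : {i // i ∉ I} → ZMod 2, ∑ y,
      G (mergeBits I y fun i => if h : i ∈ I then 0 else u ⟨i, h⟩) := by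
  rw [← (Equiv.piEquivPiSubtypeProd (fun i => i ∈ I) fun _ => ZMod 2).symm.sum_comp,
    Fintype.sum_prod_type_right]
  refine Finset.sum_congr rfl fun u _ => Finset.sum_congr rfl fun y _ => ?_
  congr 1
  funext i
  by_cases h : i ∈ I <;> simp [mergeBits, h, Equiv.piEquivPiSubtypeProd]

theorem sum_prod_compl (I : Finset (Fin n)) (g : Fin n → ZMod 2 → ℝ) :
    ∑ u : {i // i ∉ I} → ZMod 2,
      ∏ i ∈ Iᶜ, g i (if h : i ∈ I then 0 else u ⟨i, h⟩) = ∏ i ∈ Iᶜ, ∑ x, g i x := by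
  have e : ∀ f : Fin n → ℝ, ∏ i ∈ Iᶜ, f i = ∏ i : {i // i ∉ I}, f i := fun f =>
    Finset.prod_subtype _ (by simp) f
  simp only [e]
  rw [Fintype.prod_sum]
  refine Finset.sum_congr rfl fun u _ => Finset.prod_congr rfl fun i _ => ?_
  rw [dif_neg i.2]

end Merge

/-! ### Hashing part of a string encoded in a product state -/

section ProductHash

variable {n : ℕ} {d : Fin n → ℕ} {I : Finset (Fin n)} {ι S C : Type*} [Fintype ι]
  [Fintype S] [DecidableEq S] [Nonempty S] [Fintype C] [DecidableEq C]
  {ρ U : ∀ i, ZMod 2 → Matrix (Fin (d i)) (Fin (d i)) ℂ} {r : ∀ i, ZMod 2 → Fin (d i) → ℝ}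
  {V : ∀ i, Matrix (Fin (d i)) (Fin (d i)) ℂ} {s : ∀ i, Fin (d i) → ℝ}

/-- The leftover hash lemma for the bits in `I` of a string encoded into a product state, given
the other bits `u` of the string. -/
theorem leftover_hash_piTensor (h : ∀ i, IsJointDiagonalization (ρ i) (U i) (r i) (V i) (s i))
    {hash : ι → ({i // i ∈ I} → ZMod 2) → S}
    (h2 : ∀ y y', y ≠ y' → ((Finset.univ.filter fun f => hash f y = hash f y').card : ℝ) *
      Fintype.card S ≤ Fintype.card ι) (syn : ({i // i ∈ I} → ZMod 2) → C) (u : BitString n)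
    {W : ι → S → C → Matrix (∀ i, Fin (d i)) (∀ i, Fin (d i)) ℂ}
    (hW : ∀ f z c, IsRowContraction (W f z c)) {lam κ : ℝ} (hlam : 0 < lam) (hκ : 0 ≤ κ) :
    ∑ f, ∑ y, ∑ z, hashDeviation hash f z y *
      (Matrix.trace (W f z (syn y) * piTensor fun i => ρ i (mergeBits I y u i))).re ≤
    Fintype.card ι * ((√(2 * lam * Fintype.card S * Fintype.card C) * (∏ i ∈ I, ∑ b, s i b) +
      2 * √(lam ^ (-κ) * ∏ i ∈ I, (∑ b, s i b) *
        ∑ x, overlapMoment κ (r i x) (s i) ((U i x)ᴴ * V i))) *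
      ∏ i ∈ Iᶜ, ∑ a, r i (u i) a) := by
  -- The reference operator is a product: the averaged state at the unknown positions in `I`, the
  -- actual state at the known ones.
  set V' : ∀ i, Matrix (Fin (d i)) (Fin (d i)) ℂ := fun i => if i ∈ I then V i else U i (u i)
    with hV'
  set s' : ∀ i, Fin (d i) → ℝ := fun i => if i ∈ I then s i else r i (u i) with hs'
  have hVu : ∀ i, (V' i)ᴴ * V' i = 1 := by
    intro i
    simp only [hV']
    split_ifs
    · exact (h i).diag_sum.unitary
    · exact ((h i).diag _).unitary
  have hs0 : ∀ i b, 0 ≤ s' i b := by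
    intro i b
    simp only [hs']
    split_ifs
    · exact (h i).nonneg_sum b
    · exact (h i).nonneg _ b
  have hT0 : ∀ i, 0 ≤ ∑ a, r i (u i) a := fun i => Finset.sum_nonneg fun a _ => (h i).nonneg _ a
  have hP0 : ∀ i, 0 ≤ ∑ b, s i b := fun i => Finset.sum_nonneg fun b _ => (h i).nonneg_sum b
  set T := ∏ i ∈ Iᶜ, ∑ a, r i (u i) a
  set P := ∏ i ∈ I, ∑ b, s i b with hP
  have hT : 0 ≤ T := Finset.prod_nonneg fun i _ => hT0 i
  have hPn : 0 ≤ P := Finset.prod_nonneg fun i _ => hP0 i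
  have main := leftover_hash h2 syn
    (fun y => IsDiagonalization.piTensor fun i => (h i).diag (mergeBits I y u i))
    (fun y a => Finset.prod_nonneg fun i _ => (h i).nonneg _ _)
    (V := piTensor V') (by rw [piTensor_conjTranspose, piTensor_mul]; simp only [hVu, piTensor_one])
    (s := fun e => ∏ i, s' i (e i)) (fun b => Finset.prod_nonneg fun i _ => hs0 i _)
    hlam.le hW
  refine main.trans (mul_le_mul_of_nonneg_left ?_ (Nat.cast_nonneg _))
  have hr_sum : ∑ y, ∑ a : ∀ i, Fin (d i), ∏ i, r i (mergeBits I y u i) (a i) = P * T := by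
    simp only [← Fintype.prod_sum]
    rw [sum_prod_mergeBits (fun i x => ∑ a, r i x a)]
    simp only [(h _).sum_eigenvalues, P, T]
  have hs_sum : ∑ b : ∀ i, Fin (d i), ∏ i, s' i (b i) = P * T := by
    rw [← Fintype.prod_sum, ← Finset.prod_mul_prod_compl I]
    congr 1
    · exact Finset.prod_congr rfl fun i hi => by simp only [hs', if_pos hi]
    · exact Finset.prod_congr rfl fun i hi => by
        simp only [hs', if_neg (Finset.mem_compl.mp hi)]
  set Q : Fin n → ZMod 2 → ℝ := fun i x =>
    if i ∈ I then overlapMoment κ (r i x) (s i) ((U i x)ᴴ * V i) else ∑ a, r i (u i) a with hQ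
  have htail : ∀ y, spectralTail lam (fun e => ∏ i, r i (mergeBits I y u i) (e i))
      (fun e => ∏ i, s' i (e i)) ((piTensor fun i => U i (mergeBits I y u i))ᴴ * piTensor V') ≤
      lam ^ (-κ) * ∏ i, Q i (mergeBits I y u i) := by
    intro y
    rw [piTensor_conjTranspose, piTensor_mul]
    refine (spectralTail_piTensor_le (fun i a => (h i).nonneg _ a) hs0 ?_ hlam hκ).trans
      (le_of_eq ?_)
    · intro i a b hb
      by_cases hi : i ∈ I
      · simp only [hs', hV', if_pos hi] at hb ⊢
        exact (h i).weight_eq_zero hb _ _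
      · simp only [hs', hV', if_neg hi, mergeBits_of_notMem y u hi] at hb ⊢
        rw [((h i).diag _).unitary, Matrix.one_apply]
        split_ifs with hab
        · rw [hab, hb, zero_mul]
        · simp
    · congr 1
      refine Finset.prod_congr rfl fun i _ => ?_
      by_cases hi : i ∈ I
      · simp only [hQ, hs', hV', if_pos hi]
      · simp only [hQ, hs', hV', if_neg hi, mergeBits_of_notMem y u hi]
        exact overlapMoment_self ((h i).diag _).unitary _ _
  have htail_sum : ∑ y, spectralTail lam (fun e => ∏ i, r i (mergeBits I y u i) (e i))
      (fun e => ∏ i, s' i (e i)) ((piTensor fun i => U i (mergeBits I y u i))ᴴ * piTensor V') ≤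
      lam ^ (-κ) * ((∏ i ∈ I, ∑ x, overlapMoment κ (r i x) (s i) ((U i x)ᴴ * V i)) * T) := by
    refine (Finset.sum_le_sum fun y _ => htail y).trans (le_of_eq ?_)
    rw [← Finset.mul_sum, sum_prod_mergeBits Q]
    congr 2
    · exact Finset.prod_congr rfl fun i hi => by simp only [hQ, if_pos hi]
    · exact Finset.prod_congr rfl fun i hi => by simp only [hQ, if_neg (Finset.mem_compl.mp hi)]
  rw [hr_sum, hs_sum]
  have e1 : √(2 * lam * Fintype.card S * Fintype.card C * (P * T) * (P * T)) =
      √(2 * lam * Fintype.card S * Fintype.card C) * P * T := by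
    rw [mul_assoc (2 * lam * Fintype.card S * Fintype.card C) (P * T),
      Real.sqrt_mul (by positivity), Real.sqrt_mul_self (by positivity), ← mul_assoc]
  -- Both factors under the root contain the trace `T` of the known positions, so it comes out as a
  -- plain factor and can be summed over `u` later.
  have e2 : √(P * T * ∑ y, spectralTail lam (fun e => ∏ i, r i (mergeBits I y u i) (e i))
      (fun e => ∏ i, s' i (e i)) ((piTensor fun i => U i (mergeBits I y u i))ᴴ * piTensor V')) ≤
      √(lam ^ (-κ) * ∏ i ∈ I, (∑ b, s i b) *
        ∑ x, overlapMoment κ (r i x) (s i) ((U i x)ᴴ * V i)) * T := by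
    rw [Finset.prod_mul_distrib, ← hP]
    refine (Real.sqrt_le_sqrt (mul_le_mul_of_nonneg_left htail_sum
      (mul_nonneg hPn hT))).trans (le_of_eq ?_)
    rw [← Real.sqrt_mul_self hT, ← Real.sqrt_mul' _ (mul_self_nonneg T),
      Real.sqrt_mul_self hT]
    congr 1
    ring
  rw [e1, add_mul]
  refine add_le_add le_rfl ?_
  rw [mul_assoc 2]
  exact mul_le_mul_of_nonneg_left e2 zero_le_two

end ProductHash

/-! ## Distance from uniform, as a game -/

section Experiment

variable {X C d : Type*} [Fintype X] [DecidableEq X] [Fintype C] [DecidableEq C] [Fintype d]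
  [DecidableEq d]

/-- An optimal test for the trace norm is paired with an operator that is block diagonal in both
classical registers, so only its diagonal blocks matter, and these are contractions. -/
theorem exists_contraction_nonUniformity (T : X → C → Matrix d d ℂ) :
    ∃ W : X → C → Matrix d d ℂ, (∀ x c, IsRowContraction (W x c)) ∧
      nonUniformity (fun x => Matrix.blockDiagonal (T x)) =
        1 / 2 * ∑ c, ∑ y, ∑ z, ((Fintype.card X : ℝ)⁻¹ - if y = z then 1 else 0) *
          (Matrix.trace (W z c * T y c)).re := by
  have hT : ∀ z, ((Fintype.card X : ℂ)⁻¹ • ∑ y, Matrix.blockDiagonal (T y)) -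
      Matrix.blockDiagonal (T z) =
      Matrix.blockDiagonal fun c =>
        ∑ y, (((Fintype.card X : ℝ)⁻¹ - if y = z then 1 else 0 : ℝ) : ℂ) • T y c := by
    intro z
    ext p q
    simp only [Matrix.sub_apply, Matrix.smul_apply, Matrix.sum_apply,
      Matrix.blockDiagonal_apply, smul_eq_mul]
    split_ifs with h
    · simp only [Complex.ofReal_sub, sub_mul, Finset.sum_sub_distrib, ← Finset.mul_sum]
      simp [Finset.sum_ite_eq', apply_ite Complex.ofReal]
    · simp
  obtain ⟨W, hW, hWe⟩ := exists_contraction_traceNorm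
    (Matrix.blockDiagonal fun z => ((Fintype.card X : ℂ)⁻¹ • ∑ y, Matrix.blockDiagonal (T y)) -
      Matrix.blockDiagonal (T z))
  refine ⟨fun z c => Matrix.of fun i j =>
    (Matrix.of fun i j => W (i, z) (j, z) : Matrix (d × C) (d × C) ℂ) (i, c) (j, c),
    fun z c => (hW.block z).block c, ?_⟩
  rw [nonUniformity, hWe, trace_mul_blockDiagonal]
  congr 1
  simp only [hT, trace_mul_blockDiagonal, Complex.re_sum, Matrix.mul_sum, Matrix.trace_sum,
    Matrix.mul_smul, Matrix.trace_smul, smul_eq_mul, Complex.re_ofReal_mul]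
  rw [Finset.sum_comm]
  exact Finset.sum_congr rfl fun c _ => Finset.sum_comm

/-- The distance from uniform of one of two strings, the other of which, together with its
label and a classical view, is known to the adversary. -/
theorem exists_contraction_nonUniformity_outputs {Ω S Vw : Type*} [Fintype Ω] [Fintype S]
    [DecidableEq S] [Fintype Vw] [DecidableEq Vw] (M : Ω → Matrix d d ℂ) (out : Ω → Bool → S)
    (view : Ω → Vw) (D : Vw → Bool) (τ : Bool → (Bool → S) → Vw → Matrix d d ℂ)
    (hτ : ∀ D' s v, τ D' s v =
      if D' = D v then ∑ ω, if out ω = s ∧ view ω = v then M ω else 0 else 0) :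
    ∃ W : S → S × Bool × Vw → Matrix d d ℂ, (∀ z c, IsRowContraction (W z c)) ∧
      nonUniformity (fun z => Matrix.blockDiagonal fun c : S × Bool × Vw =>
        τ c.2.1 (fun b => if b = c.2.1 then c.1 else z) c.2.2) =
      1 / 2 * ∑ ω, ∑ z,
        ((Fintype.card S : ℝ)⁻¹ - if out ω (!D (view ω)) = z then 1 else 0) *
          (Matrix.trace (W z (out ω (D (view ω)), D (view ω), view ω) * M ω)).re := by
  obtain ⟨W, hW, hWe⟩ := exists_contraction_nonUniformity fun (z : S) (c : S × Bool × Vw) =>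
    τ c.2.1 (fun b => if b = c.2.1 then c.1 else z) c.2.2
  refine ⟨W, hW, ?_⟩
  rw [hWe]
  congr 1
  -- Every run contributes to exactly one value of the known registers and one value of the hidden
  -- string.
  have hT : ∀ (y : S) (c : S × Bool × Vw), τ c.2.1 (fun b => if b = c.2.1 then c.1 else y) c.2.2 =
      ∑ ω, if c = (out ω (D (view ω)), D (view ω), view ω) then
        if y = out ω (!D (view ω)) then M ω else 0 else 0 := by
    rintro y ⟨c1, D', v⟩
    rw [hτ]
    dsimp only
    split_ifs with hD
    · refine Finset.sum_congr rfl fun ω _ => ?_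
      rw [← ite_and]
      refine if_congr ?_ rfl rfl
      constructor
      · rintro ⟨h1, h2⟩
        subst h2
        rw [h1, ← hD]
        simp
      · rintro ⟨h1, h2⟩
        simp only [Prod.mk.injEq] at h1
        obtain ⟨h3, h4, rfl⟩ := h1
        refine ⟨?_, rfl⟩
        funext b
        rw [h3, h2, ← h4]
        by_cases hb : b = D'
        · rw [if_pos hb, hb]
        · rw [if_neg hb, Bool.eq_not_of_ne hb]
    · symm
      refine Finset.sum_eq_zero fun ω _ => if_neg ?_
      rintro h
      simp only [Prod.mk.injEq] at h
      exact hD (by rw [h.2.1, h.2.2])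
  simp only [hT, Matrix.trace_sum, Complex.re_sum, Finset.mul_sum]
  calc _ = ∑ c, ∑ y, ∑ ω, ∑ z, _ := Finset.sum_congr rfl fun c _ =>
        Finset.sum_congr rfl fun y _ => Finset.sum_comm
    _ = ∑ c, ∑ ω, ∑ y, ∑ z, _ := Finset.sum_congr rfl fun c _ => Finset.sum_comm
    _ = ∑ ω, ∑ c, ∑ y, ∑ z, _ := Finset.sum_comm
    _ = _ := by
      refine Finset.sum_congr rfl fun ω _ => ?_
      rw [Finset.sum_eq_single (out ω (D (view ω)), D (view ω), view ω)]
      · rw [Finset.sum_eq_single (out ω (!D (view ω)))]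
        · simp
        · intro y _ hy
          simp [hy]
        · simp
      · intro c _ hc
        simp [hc]
      · simp

end Experiment

/-! ## The moment bound for a random choice of basis -/

section Moments

/-- The power mean inequality between exponents 1 and 4. One square root of the moments comes from
Cauchy–Schwarz in the leftover hash lemma, the other from the geometric mean over the two bases. -/
theorem sqrt_sqrt_add_le {x y g : ℝ} (hx : 0 ≤ x) (hy : 0 ≤ y) (hg : 0 ≤ g)
    (h : x + y ≤ 2 * g ^ 4) : √√x + √√y ≤ 2 * g := by
  set a := √√x
  set b := √√y
  have ha : a ^ 4 = x := by
    rw [show a ^ 4 = (a ^ 2) ^ 2 by ring, Real.sq_sqrt (Real.sqrt_nonneg x), Real.sq_sqrt hx]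
  have hb : b ^ 4 = y := by
    rw [show b ^ 4 = (b ^ 2) ^ 2 by ring, Real.sq_sqrt (Real.sqrt_nonneg y), Real.sq_sqrt hy]
  have h2 : (a + b) ^ 2 ≤ 2 * (a ^ 2 + b ^ 2) := by nlinarith [sq_nonneg (a - b)]
  have h3 : (a ^ 2 + b ^ 2) ^ 2 ≤ 2 * (a ^ 4 + b ^ 4) := by
    nlinarith [sq_nonneg (a ^ 2 - b ^ 2)]
  have h4 : ((a + b) ^ 2) ^ 2 ≤ (2 * (a ^ 2 + b ^ 2)) ^ 2 := by gcongr
  refine le_of_pow_le_pow_left₀ (n := 4) (by norm_num) (by positivity) ?_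
  rw [ha, hb] at h3
  nlinarith

/-- The smaller of two products over complementary parts of `R`. -/
theorem sqrt_prod_le_prod_sqrt_sqrt {α : Type*} [DecidableEq α] {φ : α → ℝ}
    (hφ : ∀ i, 0 ≤ φ i) {I J : Finset α} (hIJ : Disjoint I J)
    (hle : ∏ i ∈ I, φ i ≤ ∏ i ∈ J, φ i) :
    √(∏ i ∈ I, φ i) ≤ ∏ i ∈ I ∪ J, √√(φ i) := by
  have h0 : 0 ≤ ∏ i ∈ I ∪ J, √√(φ i) := Finset.prod_nonneg fun i _ => Real.sqrt_nonneg _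
  have hI : 0 ≤ ∏ i ∈ I, φ i := Finset.prod_nonneg fun i _ => hφ i
  -- After fourth powers this is `(∏_I φ)² ≤ ∏_I φ * ∏_J φ`.
  refine le_of_pow_le_pow_left₀ (n := 4) (by norm_num) h0 ?_
  rw [← Finset.prod_pow, show √(∏ i ∈ I, φ i) ^ 4 = (√(∏ i ∈ I, φ i) ^ 2) ^ 2 by ring,
    Real.sq_sqrt hI, Finset.prod_union hIJ]
  have e : ∀ i, √√(φ i) ^ 4 = φ i := fun i => by
    rw [show √√(φ i) ^ 4 = (√√(φ i) ^ 2) ^ 2 by ring, Real.sq_sqrt (Real.sqrt_nonneg _),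
      Real.sq_sqrt (hφ i)]
  simp only [e, sq]
  gcongr

/-- The sum over all bases factorises over the positions; one outside `R` contributes exactly 2. -/
theorem sum_prod_bool_le {n : ℕ} {R : Finset (Fin n)} {a : Fin n → Bool → ℝ} {g : ℝ}
    (ha : ∀ i b, 0 ≤ a i b) (hag : ∀ i, a i false + a i true ≤ 2 * g) :
    ∑ θ : Fin n → Bool, ∏ i ∈ R, a i (θ i) ≤ 2 ^ n * g ^ R.card := by
  calc ∑ θ : Fin n → Bool, ∏ i ∈ R, a i (θ i)
      = ∑ θ : Fin n → Bool, ∏ i, if i ∈ R then a i (θ i) else 1 := by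
        refine Finset.sum_congr rfl fun θ _ => ?_
        simp [Finset.prod_ite_mem]
    _ = ∏ i, ∑ b, if i ∈ R then a i b else 1 :=
        (Fintype.prod_sum fun i b => if i ∈ R then a i b else 1).symm
    _ ≤ ∏ i, 2 * if i ∈ R then g else 1 := by
        refine Finset.prod_le_prod (fun i _ => Finset.sum_nonneg fun b _ => ?_) fun i _ => ?_
        · split_ifs
          · exact ha i b
          · exact zero_le_one
        · rw [Fintype.sum_bool]
          split_ifs
          · linarith [hag i]
          · norm_num
    _ = 2 ^ n * g ^ R.card := by
        rw [Finset.prod_mul_distrib]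
        simp [Finset.prod_ite_mem]

end Moments

/-! ## Moment bounds for the stored states -/

namespace PartialMeasurement

variable {d d' : ℕ} (P : PartialMeasurement d) (N : QuantumOperation d d')

theorem exists_jointDiagonalization (k : Fin P.outcomes) (θ : Bool) :
    ∃ U r V s, IsJointDiagonalization (fun x => storedState P N k x θ) U r V s :=
  IsJointDiagonalization.exists_of_posSemidef fun x => storedState_posSemidef P N k x θ

variable {P N} {k : Fin P.outcomes} {θ : Bool} {U : ZMod 2 → Matrix (Fin d') (Fin d') ℂ}
  {r : ZMod 2 → Fin d' → ℝ} {V : Matrix (Fin d') (Fin d') ℂ} {s : Fin d' → ℝ}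

theorem sum_eigenvalues_eq_weight
    (h : IsJointDiagonalization (fun x => storedState P N k x θ) U r V s) :
    ∑ b, s b = P.weight k := by
  have := h.diag_sum.trace_eq
  rw [trace_sum_storedState] at this
  exact_mod_cast this.symm

/-- Some outcome has positive weight, and a single bit has entropy at most one given that outcome.
This is what later bounds `δ`, hence the order `κ` of the moments. -/
theorem le_one_of_le_roundEntropy (P : PartialMeasurement d) (N : QuantumOperation d d')
    {t : ℝ} (ht : ∀ P : PartialMeasurement d, t ≤ roundEntropy P N) : t ≤ 1 := by
  obtain ⟨k, -, hk⟩ : ∃ k ∈ Finset.univ, 0 < P.weight k := by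
    refine Finset.exists_lt_of_sum_lt (f := fun _ => (0 : ℝ)) ?_
    rw [P.sum_weight]
    simp
  have hH : ∀ θ, blockEntropy (fun x => storedState P N k x θ) ≤ P.weight k := by
    intro θ
    obtain ⟨U, r, V, s, h⟩ := P.exists_jointDiagonalization N k θ
    have := h.blockEntropy_le
    rw [sum_eigenvalues_eq_weight h, ZMod.card] at this
    exact le_of_mul_le_mul_left this (Real.log_pos one_lt_two)
  have := P.blockEntropy_add_ge N ht k
  nlinarith [hH false, hH true]

theorem overlapMoment_nonneg {d : ℕ} {κ : ℝ} {r s : Fin d → ℝ} (hr : ∀ a, 0 ≤ r a)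
    (hs : ∀ b, 0 ≤ s b) (K : Matrix (Fin d) (Fin d) ℂ) : 0 ≤ overlapMoment κ r s K :=
  Finset.sum_nonneg fun a _ => Finset.sum_nonneg fun b _ =>
    mul_nonneg (mul_nonneg (hr a) (sq_nonneg _)) (Real.rpow_nonneg (div_nonneg (hr a) (hs b)) _)

/-- Averaged over the basis, the moments are controlled by the uncertainty bound. -/
theorem sqrt_sqrt_moment_add_le {U : Bool → ZMod 2 → Matrix (Fin d') (Fin d') ℂ}
    {r : Bool → ZMod 2 → Fin d' → ℝ} {V : Bool → Matrix (Fin d') (Fin d') ℂ}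
    {s : Bool → Fin d' → ℝ}
    (h : ∀ θ, IsJointDiagonalization (fun x => storedState P N k x θ) (U θ) (r θ) (V θ) (s θ))
    {t κ : ℝ} (ht : ∀ P : PartialMeasurement d, t ≤ roundEntropy P N) (hκ : 0 ≤ κ)
    (hκ' : κ ≤ 1 / 32) {φ : Bool → ℝ}
    (hφ : ∀ θ, φ θ =
      (∑ x, overlapMoment κ (r θ x) (s θ) ((U θ x)ᴴ * V θ)) / P.weight k) :
    √√(φ false) + √√(φ true) ≤ 2 * Real.exp (-(κ / 4) * (Real.log 2 * t - 9 * κ)) := by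
  have hφ0 : ∀ θ, 0 ≤ φ θ := fun θ => by
    rw [hφ]
    exact div_nonneg (Finset.sum_nonneg fun x _ =>
      overlapMoment_nonneg ((h θ).nonneg x) (h θ).nonneg_sum _) (P.weight_nonneg k)
  refine sqrt_sqrt_add_le (hφ0 _) (hφ0 _) (Real.exp_pos _).le ?_
  rcases (P.weight_nonneg k).eq_or_lt with h0 | hw
  · rw [hφ, hφ, ← h0]
    simp only [div_zero, add_zero]
    positivity
  -- The constant is `3 κ² (|X| + 1)` with `|X| = 2`.
  have hle : ∀ θ, φ θ * P.weight k ≤ (1 + 9 * κ ^ 2) * P.weight k - κ * (Real.log 2 *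
      blockEntropy (fun x => storedState P N k x θ)) := by
    intro θ
    rw [hφ, div_mul_cancel₀ _ hw.ne']
    refine ((h θ).overlapMoment_le hκ hκ').trans (le_of_eq ?_)
    rw [sum_eigenvalues_eq_weight (h θ), ZMod.card]
    push_cast
    ring
  have hH := P.blockEntropy_add_ge N ht k
  have hl : 0 ≤ κ * Real.log 2 := mul_nonneg hκ (Real.log_nonneg one_le_two)
  have h1 : (φ false + φ true) * P.weight k ≤
      (2 * (1 + (9 * κ ^ 2 - κ * Real.log 2 * t))) * P.weight k := by
    nlinarith [hle false, hle true, mul_le_mul_of_nonneg_left hH hl]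
  refine (le_of_mul_le_mul_right h1 hw).trans ?_
  gcongr
  -- The fourth power removes the `1 / 4` in the exponent; what remains is `1 + x ≤ exp x`.
  rw [← Real.exp_nat_mul]
  refine le_trans (le_of_eq (add_comm _ _))
    ((Real.add_one_le_exp _).trans (Real.exp_le_exp.mpr (le_of_eq ?_)))
  push_cast
  ring

end PartialMeasurement

/-! ## The parameters -/

theorem binaryEntropy_eq (p : ℝ) : binaryEntropy p = Real.binEntropy p / Real.log 2 := by
  rw [binaryEntropy, Real.binEntropy, Real.logb, Real.logb, Real.log_inv, Real.log_inv]
  ring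

theorem binaryEntropy_nonneg {p : ℝ} (h0 : 0 ≤ p) (h1 : p ≤ 1) : 0 ≤ binaryEntropy p := by
  rw [binaryEntropy_eq]
  exact div_nonneg (Real.binEntropy_nonneg h0 h1) (Real.log_nonneg one_le_two)

theorem binaryEntropy_le_one (p : ℝ) : binaryEntropy p ≤ 1 := by
  rw [binaryEntropy_eq, div_le_one (Real.log_pos one_lt_two)]
  exact Real.binEntropy_le_log_two

section Parameters

variable {n l σ p ε h t δ : ℝ}

/-- For `ε < 1/2` one has `log (1/ε) > 1`, which outweighs the `1/2`; a nonnegative length therefore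
forces the main term to be positive. -/
theorem sub_pos_of_length_bound (hl0 : 0 ≤ l) (hn : 0 ≤ n) (hε : 0 < ε) (hε2 : ε < 1 / 2)
    (hp : ε < 1 - p)
    (hl : l ≤ (t - δ - h) * (1 - p) * n / 4 - ε * n / 2 + 1 / 2 - Real.logb 2 (1 / ε)) :
    0 < n ∧ 0 < t - δ - h := by
  have hL : 1 < Real.logb 2 (1 / ε) := by
    rw [Real.lt_logb_iff_rpow_lt one_lt_two (by positivity), Real.rpow_one,
      lt_div_iff₀ hε]
    linarith
  have hεn : 0 ≤ ε * n := by positivity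
  have h1 : 0 < (t - δ - h) * ((1 - p) * n) := by nlinarith
  have hpn : 0 ≤ (1 - p) * n := mul_nonneg (by linarith) hn
  have h2 : 0 < (1 - p) * n := by
    rcases hpn.eq_or_lt with h3 | h3
    · rw [← h3, mul_zero] at h1
      exact absurd h1 (lt_irrefl _)
    · exact h3
  exact ⟨pos_of_mul_pos_right h2 (by linarith), pos_of_mul_pos_left h1 hpn⟩

/-- Twice the length bound gives the exponent `2 - 2 log (1/ε) - l` at most. The deviations of the
string and syndrome lengths from their nominal values cost `(t - δ + h) ε n / 2 ≤ ε n`, which the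
term `-ε n / 2` pays for. The leftover `-l` is discarded. -/
theorem hash_error_le (hl0 : 0 ≤ l) (hn : 0 ≤ n) (hε : 0 < ε)
    (htδ : t - δ ≤ 1) (hh1 : h ≤ 1)
    (hσ : σ ≤ h * (1 - p + ε) * n / 2)
    (hl : l ≤ (t - δ - h) * (1 - p) * n / 4 - ε * n / 2 + 1 / 2 - Real.logb 2 (1 / ε)) :
    √(2 * (2 : ℝ) ^ (-((t - δ) * ((1 - p - ε) * n) / 2)) * 2 ^ l * 2 ^ σ) ≤ 2 * ε := by
  rw [Real.sqrt_le_left (by positivity)]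
  have e1 : 2 * (2 : ℝ) ^ (-((t - δ) * ((1 - p - ε) * n) / 2)) * 2 ^ l * 2 ^ σ =
      2 ^ (1 + -((t - δ) * ((1 - p - ε) * n) / 2) + l + σ) := by
    rw [Real.rpow_add two_pos, Real.rpow_add two_pos, Real.rpow_add two_pos, Real.rpow_one]
  have e2 : (2 * ε) ^ 2 = (2 : ℝ) ^ (2 - 2 * Real.logb 2 (1 / ε)) := by
    rw [one_div, Real.logb_inv, show 2 - 2 * -Real.logb 2 ε = (1 + Real.logb 2 ε) * (2 : ℕ) by
      push_cast; ring, Real.rpow_mul two_pos.le, Real.rpow_natCast, Real.rpow_add two_pos,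
      Real.rpow_one, Real.rpow_logb two_pos (by norm_num) hε]
  rw [e1, e2]
  apply Real.rpow_le_rpow_of_exponent_le one_le_two
  have hεn : 0 ≤ ε * n := by positivity
  nlinarith [mul_nonneg hεn (sub_nonneg.mpr htδ), mul_nonneg hεn (sub_nonneg.mpr hh1)]

/-- With `κ = δ / 32` the contributions of `t` cancel and the exponent is `(δ² m / 128)(9/32 - log
2)`. Since `δ² m = 64 log₂ (2/ε⁴)`, this is `½ log₂ (2/ε⁴) (9/32 - log 2)`, which is at most `log ε`
because `log 2 > 9/16`. -/
theorem tail_error_le {m : ℝ} (hε : 0 < ε) (hε1 : ε < 1) (hm : 0 < m)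
    (hδ : δ = 8 * √(Real.logb 2 (2 / ε ^ 4) / m)) :
    √(((2 : ℝ) ^ (-((t - δ) * m / 2))) ^ (-(δ / 32))) *
      Real.exp (-(δ / 32 / 4) * (Real.log 2 * t - 9 * (δ / 32))) ^ m ≤ ε := by
  have hlog2 := Real.log_two_gt_d9
  have hq : 0 < Real.log 2 := by linarith
  have hlε : Real.log ε < 0 := Real.log_neg hε hε1
  have hL : Real.log 2 * Real.logb 2 (2 / ε ^ 4) = Real.log 2 - 4 * Real.log ε := by
    rw [Real.logb, mul_div_cancel₀ _ hq.ne', Real.log_div two_ne_zero (by positivity),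
      Real.log_pow]
    norm_num
  have hL0 : 0 ≤ Real.logb 2 (2 / ε ^ 4) := by
    by_contra hc
    push Not at hc
    nlinarith
  have hδ2 : δ ^ 2 * m = 64 * Real.logb 2 (2 / ε ^ 4) := by
    rw [hδ, mul_pow, Real.sq_sqrt (by positivity)]
    field_simp
    ring
  rw [← Real.exp_mul, ← Real.rpow_mul two_pos.le, Real.rpow_def_of_pos two_pos, ← Real.exp_half,
    ← Real.exp_add]
  conv_rhs => rw [← Real.exp_log hε]
  apply Real.exp_le_exp.mpr
  have e : Real.log 2 * (-((t - δ) * m / 2) * -(δ / 32)) / 2 +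
      -(δ / 32 / 4) * (Real.log 2 * t - 9 * (δ / 32)) * m =
      δ ^ 2 * m / 128 * (9 / 32 - Real.log 2) := by ring
  rw [e, hδ2]
  nlinarith

end Parameters

/-! ## The dishonest receiver -/

section Strings

theorem sum_bool_fun {ι : Type*} [Fintype ι] (b : Bool) (G : (Bool → ι) → ℝ) :
    ∑ F, G F = ∑ g, ∑ f, G fun c => if c = b then f else g := by
  classical
  rw [← (Equiv.boolArrowEquivProd ι).symm.sum_comp, Fintype.sum_prod_type]
  cases b
  · rw [Finset.sum_comm]
    refine Finset.sum_congr rfl fun g _ => Finset.sum_congr rfl fun f _ => ?_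
    refine congrArg G (funext fun c => ?_)
    cases c <;> rfl
  · refine Finset.sum_congr rfl fun g _ => Finset.sum_congr rfl fun f _ => ?_
    refine congrArg G (funext fun c => ?_)
    cases c <;> rfl

variable {n : ℕ}

/-- For fixed `I` the unpadded length is fixed, so padding is injective and two-universality passes
to the strings on `I`. -/
theorem padZero_restrict_eq_iff {x x' : BitString n} {I : Finset (Fin n)} :
    padZero n (restrict x I) = padZero n (restrict x' I) ↔ ∀ i ∈ I, x i = x' i := by
  constructor
  · intro h i hi
    set j : Fin I.card := (I.orderIsoOfFin rfl).symm ⟨i, hi⟩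
    have hj : I.orderEmbOfFin rfl j = i := by
      rw [← Finset.coe_orderIsoOfFin_apply, OrderIso.apply_symm_apply]
    have hjn : (j : ℕ) < n := j.2.trans_le (by simpa using Finset.card_le_univ I)
    have := congrFun h ⟨j, hjn⟩
    simpa [padZero, restrict, hj] using this
  · intro h
    have : restrict x I = restrict x' I := funext fun _ => h _ (Finset.orderEmbOfFin_mem _ _ _)
    rw [this]

theorem restrict_mergeBits_of_disjoint {I J : Finset (Fin n)} (hIJ : Disjoint I J)
    (y : {i // i ∈ I} → ZMod 2) (u : BitString n) :
    restrict (mergeBits I y u) J = restrict u J :=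
  funext fun _ => mergeBits_of_notMem y u
    (Finset.disjoint_right.mp hIJ (Finset.orderEmbOfFin_mem _ _ _))

end Strings

/-! ### Hashing for fixed bases and outcomes -/

namespace RobustROT

variable {n ℓ : ℕ} {ι : Type} [Fintype ι]

theorem mem_positions {θ : Fin n → Bool} {R : Finset (Fin n)} {b : Bool} {i : Fin n} :
    i ∈ positions θ R b ↔ i ∈ R ∧ θ i = b := by
  simp [positions]

theorem disjoint_positions (θ : Fin n → Bool) (R : Finset (Fin n)) (b : Bool) :
    Disjoint (positions θ R (!b)) (positions θ R b) := by
  refine Finset.disjoint_left.mpr fun i hi hi' => ?_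
  rw [mem_positions] at hi hi'
  simp [hi'.2] at hi

theorem positions_union (θ : Fin n → Bool) (R : Finset (Fin n)) (b : Bool) :
    positions θ R (!b) ∪ positions θ R b = R := by
  ext i
  rw [Finset.mem_union, mem_positions, mem_positions, ← and_or_left]
  cases b <;> cases θ i <;> simp

theorem outputs_mergeBits_of_disjoint (π : RobustROT n ℓ ι) {I : Bool → Finset (Fin n)}
    {D : Bool} (hI : Disjoint (I (!D)) (I D)) (y : {i // i ∈ I (!D)} → ZMod 2)
    (u : BitString n) (F : Bool → ι) :
    π.outputs (mergeBits (I (!D)) y u) I F D = π.hash (F D) (padZero n (restrict u (I D))) := by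
  simp only [outputs, restrict_mergeBits_of_disjoint hI]

/-- The bits in `I (!D)` affect only their own syndrome; the other one is a constant once the
remaining bits are fixed. -/
theorem syn_mergeBits (π : RobustROT n ℓ ι) {I : Bool → Finset (Fin n)}
    {D : Bool} (hI : Disjoint (I (!D)) (I D)) (y : {i // i ∈ I (!D)} → ZMod 2)
    (u : BitString n) :
    (fun b => π.syn _ (restrict (mergeBits (I (!D)) y u) (I b))) =
      Function.update (fun b => π.syn _ (restrict u (I b))) (!D)
        (π.syn _ (restrict (mergeBits (I (!D)) y u) (I (!D)))) := by
  funext b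
  by_cases hb : b = !D
  · subst hb
    rw [Function.update_self]
  · rw [Function.update_of_ne hb]
    obtain rfl : b = D := (Bool.eq_not_of_ne hb).trans (Bool.not_not D)
    rw [restrict_mergeBits_of_disjoint hI]

/-- For given bases and outcomes, the distance from uniform of the string hashed from the
positions with basis `!D`. -/
theorem sum_hash_trace_le [Nonempty ι] (π : RobustROT n ℓ ι) (hhash : IsTwoUniversal π.hash)
    {d d' : Fin n → ℕ} (N : ∀ i, QuantumOperation (d i) (d' i)) (A : StorageAttack d)
    (θ : Fin n → Bool) (k : ∀ i, Fin (A.meas i).outcomes) (D : Bool)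
    {U : ∀ i, ZMod 2 → Matrix (Fin (d' i)) (Fin (d' i)) ℂ} {r : ∀ i, ZMod 2 → Fin (d' i) → ℝ}
    {V : ∀ i, Matrix (Fin (d' i)) (Fin (d' i)) ℂ} {s : ∀ i, Fin (d' i) → ℝ}
    (h : ∀ i, IsJointDiagonalization (fun x => storedState (A.meas i) (N i) (k i) x (θ i))
      (U i) (r i) (V i) (s i))
    {W : BitString ℓ → BitString ℓ × Bool × π.View A →
      Matrix (∀ i, Fin (d' i)) (∀ i, Fin (d' i)) ℂ}
    (hW : ∀ z c, IsRowContraction (W z c)) {lam κ : ℝ} (hlam : 0 < lam) (hκ : 0 ≤ κ) :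
    ∑ F : Bool → ι, ∑ x : BitString n, ∑ z, ((Fintype.card (BitString ℓ) : ℝ)⁻¹ -
        if π.outputs x (positions θ (A.report k)) F (!D) = z then 1 else 0) *
      (Matrix.trace (W z (π.outputs x (positions θ (A.report k)) F D, D, π.view A x θ k F) *
        piTensor fun i => storedState (A.meas i) (N i) (k i) (x i) (θ i))).re ≤
    (Fintype.card ι : ℝ) ^ 2 * (∏ i, (A.meas i).weight (k i)) *
      (√(2 * lam * 2 ^ ℓ * 2 ^ π.synLen (positions θ (A.report k) (!D)).card) +
      2 * √(lam ^ (-κ) * ∏ i ∈ positions θ (A.report k) (!D),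
        (∑ x, overlapMoment κ (r i x) (s i) ((U i x)ᴴ * V i)) / (A.meas i).weight (k i))) := by
  set I := positions θ (A.report k)
  set w : Fin n → ℝ := fun i => (A.meas i).weight (k i)
  have hw0 : ∀ i, 0 ≤ w i := fun i => (A.meas i).weight_nonneg _
  have hs : ∀ i, ∑ b, s i b = w i := fun i =>
    PartialMeasurement.sum_eigenvalues_eq_weight (h i)
  set Φ : Fin n → ℝ := fun i => ∑ x, overlapMoment κ (r i x) (s i) ((U i x)ᴴ * V i)
  have hcard : ∀ m : ℕ, (Fintype.card (BitString m) : ℝ) = 2 ^ m := fun m => by simp [ZMod.card]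
  have hdisj : Disjoint (I (!D)) (I D) := disjoint_positions θ _ D
  set ext : ({i // i ∉ I (!D)} → ZMod 2) → BitString n := fun u i =>
    if h : i ∈ I (!D) then 0 else u ⟨i, h⟩
  set T : BitString n → ℝ := fun u => ∏ i ∈ (I (!D))ᶜ, ∑ a, r i (u i) a with hTdef
  set Bd : ℝ := √(2 * lam * 2 ^ ℓ * 2 ^ π.synLen (I (!D)).card) * (∏ i ∈ I (!D), w i) +
    2 * √(lam ^ (-κ) * ∏ i ∈ I (!D), w i * Φ i)
  have hT : ∑ u, T (ext u) = ∏ i ∈ (I (!D))ᶜ, w i := by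
    rw [hTdef, sum_prod_compl (I (!D)) fun i x => ∑ a, r i x a]
    simp only [(h _).sum_eigenvalues, hs]
  -- With `g = F_D` and the bits outside `I (!D)` fixed, the string for `D` and its syndrome are
  -- constants that can be absorbed into the tests. Only the syndrome on `I (!D)` still varies with
  -- `y`.
  have key : ∀ (g : ι) (u : BitString n),
      ∑ f : ι, ∑ y : {i // i ∈ I (!D)} → ZMod 2, ∑ z, ((Fintype.card (BitString ℓ) : ℝ)⁻¹ -
        if π.outputs (mergeBits (I (!D)) y u) I (fun c => if c = !D then f else g) (!D) = z
          then 1 else 0) *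
      (Matrix.trace (W z (π.outputs (mergeBits (I (!D)) y u) I
          (fun c => if c = !D then f else g) D, D,
          π.view A (mergeBits (I (!D)) y u) θ k fun c => if c = !D then f else g) *
        piTensor fun i => storedState (A.meas i) (N i) (k i) (mergeBits (I (!D)) y u i) (θ i))).re ≤
      Fintype.card ι * (Bd * T u) := by
    intro g u
    have main := leftover_hash_piTensor h (I := I (!D))
      (hash := fun f y => π.hash f (padZero n (restrict (mergeBits (I (!D)) y u) (I (!D)))))
      (by
        intro y y' hy
        rw [hcard]
        have hne : padZero n (restrict (mergeBits (I (!D)) y u) (I (!D))) ≠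
            padZero n (restrict (mergeBits (I (!D)) y' u) (I (!D))) := by
          rw [Ne, padZero_restrict_eq_iff]
          intro hall
          refine hy (funext fun i => ?_)
          have := hall i i.2
          rwa [mergeBits_of_mem _ _ i.2, mergeBits_of_mem _ _ i.2] at this
        have h2 := hhash _ _ hne
        have hι : (0 : ℝ) < Fintype.card ι := by exact_mod_cast Fintype.card_pos
        rw [div_le_div_iff₀ hι (by positivity), one_mul] at h2
        exact h2)
      (fun y => π.syn _ (restrict (mergeBits (I (!D)) y u) (I (!D)))) u
      (W := fun f z c => W z (π.hash g (padZero n (restrict u (I D))), D,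
        (k, (fun c => if c = !D then f else g),
          ⟨I, Function.update (fun b => π.syn _ (restrict u (I b))) (!D) c⟩)))
      (fun f z c => hW _ _) hlam hκ
    rw [hcard, hcard] at main
    simp only [hs] at main
    refine le_trans (le_of_eq ?_) main
    refine Finset.sum_congr rfl fun f _ => Finset.sum_congr rfl fun y _ =>
      Finset.sum_congr rfl fun z _ => ?_
    rw [outputs_mergeBits_of_disjoint π hdisj, view, syn_mergeBits π hdisj, hashDeviation,
      if_neg (Bool.eq_not_self D).mp]
    simp only [outputs, if_true]
    rfl
  rw [sum_bool_fun (!D)]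
  calc _ = ∑ g : ι, ∑ u : {i // i ∉ I (!D)} → ZMod 2, ∑ f : ι,
      ∑ y : {i // i ∈ I (!D)} → ZMod 2, ∑ z, ((Fintype.card (BitString ℓ) : ℝ)⁻¹ -
        if π.outputs (mergeBits (I (!D)) y (ext u)) I (fun c => if c = !D then f else g) (!D) = z
          then 1 else 0) *
      (Matrix.trace (W z (π.outputs (mergeBits (I (!D)) y (ext u)) I
          (fun c => if c = !D then f else g) D, D,
          π.view A (mergeBits (I (!D)) y (ext u)) θ k fun c => if c = !D then f else g) *
        piTensor fun i => storedState (A.meas i) (N i) (k i)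
          (mergeBits (I (!D)) y (ext u) i) (θ i))).re := by
        refine Finset.sum_congr rfl fun g _ => ?_
        exact (Finset.sum_congr rfl fun f _ => sum_eq_sum_mergeBits (I (!D)) _).trans
          Finset.sum_comm
    _ ≤ ∑ g : ι, ∑ u : {i // i ∉ I (!D)} → ZMod 2, Fintype.card ι * (Bd * T (ext u)) :=
        Finset.sum_le_sum fun g _ => Finset.sum_le_sum fun u _ => key g (ext u)
    _ = (Fintype.card ι : ℝ) ^ 2 * (Bd * ∏ i ∈ (I (!D))ᶜ, w i) := by
        simp only [← Finset.mul_sum, hT, Finset.sum_const, Finset.card_univ, nsmul_eq_mul]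
        ring
    _ ≤ _ := by
        rw [mul_assoc]
        refine mul_le_mul_of_nonneg_left ?_ (by positivity)
        rw [← Finset.prod_mul_prod_compl (I (!D))]
        -- Writing `w Φ = w² (Φ / w)` takes the outcome weights out of the root, where they can be
        -- averaged over `k`; for `w = 0` both sides of this identity vanish.
        have hsq : √(lam ^ (-κ) * ∏ i ∈ I (!D), w i * Φ i) ≤
            (∏ i ∈ I (!D), w i) * √(lam ^ (-κ) * ∏ i ∈ I (!D), Φ i / w i) := by
          have hP : 0 ≤ ∏ i ∈ I (!D), w i := Finset.prod_nonneg fun i _ => hw0 i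
          rw [← Real.sqrt_sq hP, ← Real.sqrt_mul (by positivity)]
          apply Real.sqrt_le_sqrt
          have hterm : ∀ i, w i * Φ i = w i ^ 2 * (Φ i / w i) := fun i => by
            rcases (hw0 i).eq_or_lt with h0 | h0
            · simp [← h0]
            · field_simp
          simp only [hterm, Finset.prod_mul_distrib, Finset.prod_pow]
          exact le_of_eq (mul_left_comm _ _ _)
        have hC : 0 ≤ ∏ i ∈ (I (!D))ᶜ, w i := Finset.prod_nonneg fun i _ => hw0 i
        nlinarith [mul_le_mul_of_nonneg_right hsq hC]

end RobustROT

/-! ### From the security definition to an average over bases and outcomes -/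

namespace RobustROT

variable {n ℓ : ℕ} {ι : Type} [Fintype ι]

open Classical in
theorem finalState_eq (π : RobustROT n ℓ ι) {d d' : Fin n → ℕ}
    (N : ∀ i, QuantumOperation (d i) (d' i)) (A : StorageAttack d) (s : Bool → BitString ℓ)
    (v : π.View A) :
    π.finalState N A s v =
      ∑ ω : BitString n × (Fin n → Bool) × (∀ i, Fin (A.meas i).outcomes) × (Bool → ι),
        if π.outputs ω.1 (positions ω.2.1 (A.report ω.2.2.1)) ω.2.2.2 = s ∧
          π.view A ω.1 ω.2.1 ω.2.2.1 ω.2.2.2 = v then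
          if ∀ b, π.Accepts (positions ω.2.1 (A.report ω.2.2.1) b).card then
            (((4 ^ n * (Fintype.card ι : ℝ) ^ 2)⁻¹ : ℝ) : ℂ) •
              piTensor fun i => storedState (A.meas i) (N i) (ω.2.2.1 i) (ω.1 i) (ω.2.1 i)
          else 0
        else 0 := by
  have hc : (((4 ^ n * (Fintype.card ι : ℝ) ^ 2)⁻¹ : ℝ) : ℂ) =
      ((2 : ℂ) ^ n * 2 ^ n * (Fintype.card ι : ℂ) ^ 2)⁻¹ := by
    push_cast
    rw [← mul_pow]
    norm_num
  simp only [Fintype.sum_prod_type, hc, finalState]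
  refine Finset.sum_congr rfl fun x _ => Finset.sum_congr rfl fun θ _ =>
    Finset.sum_congr rfl fun k _ => Finset.sum_congr rfl fun F _ => ?_
  rw [← ite_and]
  exact if_congr and_comm rfl rfl

theorem posSemidef_finalState (π : RobustROT n ℓ ι) {d d' : Fin n → ℕ}
    (N : ∀ i, QuantumOperation (d i) (d' i)) (A : StorageAttack d) (s : Bool → BitString ℓ)
    (v : π.View A) : (π.finalState N A s v).PosSemidef := by
  classical
  rw [finalState_eq]
  refine Matrix.posSemidef_sum _ fun ω _ => ?_
  split_ifs
  · refine (posSemidef_piTensor fun i =>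
      PartialMeasurement.storedState_posSemidef _ _ _ _ _).smul ?_
    exact_mod_cast (by positivity : (0 : ℝ) ≤ (4 ^ n * (Fintype.card ι : ℝ) ^ 2)⁻¹)
  · exact Matrix.PosSemidef.zero
  · exact Matrix.PosSemidef.zero

open Classical in
/-- If the label `D` is a function of the receiver's classical information, then the security
error is the advantage of a family of tests `W`. -/
theorem exists_contraction_security (π : RobustROT n ℓ ι) {d d' : Fin n → ℕ}
    (N : ∀ i, QuantumOperation (d i) (d' i)) (A : StorageAttack d)
    (D : (∀ i, Fin (A.meas i).outcomes) → (Bool → Finset (Fin n)) → Bool) :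
    ∃ W : BitString ℓ → BitString ℓ × Bool × π.View A →
        Matrix (∀ i, Fin (d' i)) (∀ i, Fin (d' i)) ℂ,
      (∀ z c, IsRowContraction (W z c)) ∧
      ∀ err : ℝ, 1 / 2 * ∑ θ : Fin n → Bool, ∑ k : (∀ i, Fin (A.meas i).outcomes),
        (if ∀ b, π.Accepts (positions θ (A.report k) b).card then
          (4 ^ n * (Fintype.card ι : ℝ) ^ 2)⁻¹ *
          ∑ F : Bool → ι, ∑ x : BitString n, ∑ z, ((Fintype.card (BitString ℓ) : ℝ)⁻¹ -
            if π.outputs x (positions θ (A.report k)) F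
              (!D k (positions θ (A.report k))) = z then 1 else 0) *
          (Matrix.trace (W z (π.outputs x (positions θ (A.report k)) F
              (D k (positions θ (A.report k))), D k (positions θ (A.report k)),
              π.view A x θ k F) *
            piTensor fun i => storedState (A.meas i) (N i) (k i) (x i) (θ i))).re
        else 0) ≤ err →
      ∃ τ : Bool → (Bool → BitString ℓ) → π.View A →
          Matrix (∀ i, Fin (d' i)) (∀ i, Fin (d' i)) ℂ,
        (∀ D s v, (τ D s v).PosSemidef) ∧
        (∀ s v, ∑ D, τ D s v = π.finalState N A s v) ∧
        nonUniformity (fun sOther : BitString ℓ =>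
          Matrix.blockDiagonal fun c : BitString ℓ × Bool × π.View A =>
            τ c.2.1 (fun b => if b = c.2.1 then c.1 else sOther) c.2.2) ≤ err := by
  -- All of the final state is placed at the value of `D` computed from the receiver's classical
  -- view.
  set τ : Bool → (Bool → BitString ℓ) → π.View A →
      Matrix (∀ i, Fin (d' i)) (∀ i, Fin (d' i)) ℂ := fun D' s v =>
    if D' = D v.1 v.2.2.1 then π.finalState N A s v else 0 with hτ
  obtain ⟨W, hW, hWe⟩ := exists_contraction_nonUniformity_outputs
    (fun ω : BitString n × (Fin n → Bool) × (∀ i, Fin (A.meas i).outcomes) × (Bool → ι) =>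
      if ∀ b, π.Accepts (positions ω.2.1 (A.report ω.2.2.1) b).card then
        (((4 ^ n * (Fintype.card ι : ℝ) ^ 2)⁻¹ : ℝ) : ℂ) •
          piTensor fun i => storedState (A.meas i) (N i) (ω.2.2.1 i) (ω.1 i) (ω.2.1 i)
      else 0)
    (fun ω => π.outputs ω.1 (positions ω.2.1 (A.report ω.2.2.1)) ω.2.2.2)
    (fun ω => π.view A ω.1 ω.2.1 ω.2.2.1 ω.2.2.2) (fun v : π.View A => D v.1 v.2.2.1) τ
    (fun D' s v => by
      simp only [hτ]
      rw [finalState_eq]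
      exact if_congr Iff.rfl (Finset.sum_congr rfl fun ω _ => by congr) rfl)
  refine ⟨W, hW, fun err herr => ⟨τ, fun D' s v => ?_, fun s v => ?_, ?_⟩⟩
  · simp only [hτ]
    split_ifs
    · exact posSemidef_finalState π N A s v
    · exact Matrix.PosSemidef.zero
  · simp [hτ]
  · refine le_trans (le_of_eq ?_) herr
    rw [hWe]
    congr 1
    simp only [Fintype.sum_prod_type]
    rw [Finset.sum_comm]
    refine Finset.sum_congr rfl fun θ _ => ?_
    rw [Finset.sum_comm]
    refine Finset.sum_congr rfl fun k _ => ?_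
    rw [Finset.sum_comm]
    simp only [view]
    split_ifs with hacc
    · simp only [Finset.mul_sum, Matrix.mul_smul, Matrix.trace_smul, smul_eq_mul,
        Complex.re_ofReal_mul]
      refine Finset.sum_congr rfl fun F _ => Finset.sum_congr rfl fun x _ =>
        Finset.sum_congr rfl fun z _ => ?_
      exact mul_left_comm _ _ _
    · simp

variable [Nonempty ι]

open Classical in
/-- Averaging error bounds over the bases and the outcomes. -/
theorem average_le (π : RobustROT n ℓ ι) {d : Fin n → ℕ} (A : StorageAttack d)
    {G e : (Fin n → Bool) → (∀ i, Fin (A.meas i).outcomes) → ℝ} {E : ℝ}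
    (hG : ∀ θ k, (∀ b, π.Accepts (positions θ (A.report k) b).card) →
      G θ k ≤ (Fintype.card ι : ℝ) ^ 2 * (∏ i, (A.meas i).weight (k i)) * (2 * e θ k))
    (hE : ∀ k, ∑ θ, (if ∀ b, π.Accepts (positions θ (A.report k) b).card then e θ k else 0) ≤
      2 ^ n * E) :
    1 / 2 * ∑ θ : Fin n → Bool, ∑ k : (∀ i, Fin (A.meas i).outcomes),
      (if ∀ b, π.Accepts (positions θ (A.report k) b).card then
        (4 ^ n * (Fintype.card ι : ℝ) ^ 2)⁻¹ * G θ k else 0) ≤ E := by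
  have hι : (0 : ℝ) < Fintype.card ι := by exact_mod_cast Fintype.card_pos
  -- In each round the weights total 2, so together with the `2 ^ n` bases they cancel the
  -- normalisation `4 ^ n`.
  have hw : ∑ k : (∀ i, Fin (A.meas i).outcomes), ∏ i, (A.meas i).weight (k i) = 2 ^ n := by
    rw [← Fintype.prod_sum]
    simp [PartialMeasurement.sum_weight]
  have hw0 : ∀ k : (∀ i, Fin (A.meas i).outcomes), 0 ≤ ∏ i, (A.meas i).weight (k i) :=
    fun k => Finset.prod_nonneg fun i _ => (A.meas i).weight_nonneg _
  calc _ ≤ 1 / 2 * ∑ θ : Fin n → Bool, ∑ k : (∀ i, Fin (A.meas i).outcomes),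
        2 * (4 ^ n : ℝ)⁻¹ * ((∏ i, (A.meas i).weight (k i)) *
          if ∀ b, π.Accepts (positions θ (A.report k) b).card then e θ k else 0) := by
        gcongr with θ _ k _
        split_ifs with hacc
        · calc _ ≤ (4 ^ n * (Fintype.card ι : ℝ) ^ 2)⁻¹ * _ :=
                mul_le_mul_of_nonneg_left (hG θ k hacc) (by positivity)
            _ = _ := by field_simp
        · simp
    _ = (4 ^ n : ℝ)⁻¹ * ∑ k : (∀ i, Fin (A.meas i).outcomes), (∏ i, (A.meas i).weight (k i)) *
          ∑ θ, if ∀ b, π.Accepts (positions θ (A.report k) b).card then e θ k else 0 := by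
        rw [Finset.sum_comm]
        simp only [← Finset.mul_sum]
        ring
    _ ≤ (4 ^ n : ℝ)⁻¹ * ∑ k : (∀ i, Fin (A.meas i).outcomes),
          (∏ i, (A.meas i).weight (k i)) * (2 ^ n * E) := by
        gcongr with k _
        · exact hw0 k
        · exact hE k
    _ = E := by
        rw [← Finset.sum_mul, hw, show (4 : ℝ) ^ n = 2 ^ n * 2 ^ n by rw [← mul_pow]; norm_num]
        field_simp

/-- No test does better than twice the total weight. -/
theorem sum_trace_le (π : RobustROT n ℓ ι) {d d' : Fin n → ℕ}
    (N : ∀ i, QuantumOperation (d i) (d' i)) (A : StorageAttack d)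
    (θ : Fin n → Bool) (k : ∀ i, Fin (A.meas i).outcomes) (D : Bool)
    {W : BitString ℓ → BitString ℓ × Bool × π.View A →
      Matrix (∀ i, Fin (d' i)) (∀ i, Fin (d' i)) ℂ}
    (hW : ∀ z c, IsRowContraction (W z c)) :
    ∑ F : Bool → ι, ∑ x : BitString n, ∑ z, ((Fintype.card (BitString ℓ) : ℝ)⁻¹ -
        if π.outputs x (positions θ (A.report k)) F (!D) = z then 1 else 0) *
      (Matrix.trace (W z (π.outputs x (positions θ (A.report k)) F D, D, π.view A x θ k F) *
        piTensor fun i => storedState (A.meas i) (N i) (k i) (x i) (θ i))).re ≤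
    (Fintype.card ι : ℝ) ^ 2 * (∏ i, (A.meas i).weight (k i)) * (2 * 1) := by
  have hM : ∀ x : BitString n,
      (piTensor fun i => storedState (A.meas i) (N i) (k i) (x i) (θ i)).PosSemidef := fun x =>
    posSemidef_piTensor fun i => PartialMeasurement.storedState_posSemidef _ _ _ _ _
  calc _ ≤ ∑ F : Bool → ι, ∑ x : BitString n,
        2 * (piTensor fun i => storedState (A.meas i) (N i) (k i) (x i) (θ i)).trace.re := by
        refine Finset.sum_le_sum fun F _ => Finset.sum_le_sum fun x _ => ?_
        have h2 := sum_abs_hashDeviation_le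
          (fun (F : Bool → ι) x => π.outputs x (positions θ (A.report k)) F (!D)) F x
        have h0 : 0 ≤ (piTensor fun i =>
            storedState (A.meas i) (N i) (k i) (x i) (θ i)).trace.re :=
          (Complex.nonneg_iff.mp (hM x).trace_nonneg).1
        refine le_trans ?_ (mul_le_mul_of_nonneg_right h2 h0)
        rw [Finset.sum_mul]
        refine Finset.sum_le_sum fun z _ => (le_abs_self _).trans ?_
        rw [abs_mul]
        exact mul_le_mul_of_nonneg_left (abs_re_trace_contraction_mul_le (hW _ _) (hM x))
          (abs_nonneg _)
    _ = _ := by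
        have e : ∑ x : BitString n, (piTensor fun i =>
            storedState (A.meas i) (N i) (k i) (x i) (θ i)).trace =
            ((∏ i, (A.meas i).weight (k i) : ℝ) : ℂ) := by
          simp only [trace_piTensor, Complex.ofReal_prod]
          rw [← Fintype.prod_sum fun i x => (storedState (A.meas i) (N i) (k i) x (θ i)).trace]
          refine Finset.prod_congr rfl fun i _ => ?_
          rw [← PartialMeasurement.trace_sum_storedState (A.meas i) (N i) (k i) (θ i),
            Matrix.trace_sum]
        have e' := congrArg Complex.re e
        rw [Complex.re_sum, Complex.ofReal_re] at e'
        simp only [← Finset.mul_sum, e', Finset.sum_const, Finset.card_univ, nsmul_eq_mul,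
          Fintype.card_fun, Fintype.card_bool]
        push_cast
        ring

end RobustROT

end

theorem theorem3 {n ℓ : ℕ} {ι : Type} [Fintype ι] [Nonempty ι]
    (π : RobustROT n ℓ ι) {d d' : Fin n → ℕ} (N : ∀ i, QuantumOperation (d i) (d' i))
    (pError t δ : ℝ)
    (herase : 0 ≤ π.pErase) (herror : 0 ≤ pError) (herror' : pError < 1 / 2)
    (hε : 0 < π.ε) (hε' : π.ε < 1 - π.pErase)
    (hhash : IsTwoUniversal π.hash)
    (hsyn : ∀ m, π.Accepts m →
      (π.synLen m : ℝ) ≤ binaryEntropy pError * (1 - π.pErase + π.ε) * n / 2)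
    (ht : IsUncertaintyBound N t)
    (hδ : δ = 8 * Real.sqrt (Real.logb 2 (2 / π.ε ^ 4) / ((1 - π.pErase - π.ε) * n)))
    (hn : 8 / 5 * Real.logb 2 (2 / π.ε ^ 4) ≤ (n : ℝ))
    (hℓ : (ℓ : ℝ) ≤ (t - δ - binaryEntropy pError) * (1 - π.pErase) * n / 4
      - π.ε * n / 2 + 1 / 2 - Real.logb 2 (1 / π.ε)) :
    π.SecureAgainstReceiver N (2 * π.ε) := by
  classical
  intro A
  -- For `ε ≥ 1/2` the allowed error is at least 1, which no test exceeds; any `D` will do.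
  rcases le_or_gt (1 / 2) π.ε with hε2 | hε2
  · obtain ⟨W, hW, hWe⟩ := π.exists_contraction_security N A fun _ _ => true
    refine hWe _ (le_trans (π.average_le A (e := fun _ _ => 1) (E := 1)
      (fun θ k _ => π.sum_trace_le N A θ k true hW) fun k => ?_) (by linarith))
    refine (Finset.sum_le_sum (g := fun _ => (1 : ℝ)) fun θ _ => ?_).trans (le_of_eq ?_)
    · split_ifs <;> norm_num
    · simp
  have hε1 : π.ε < 1 := by linarith
  obtain ⟨hn0, hth⟩ := sub_pos_of_length_bound (Nat.cast_nonneg ℓ) (Nat.cast_nonneg n) hε hε2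
    hε' hℓ
  have hh0 := binaryEntropy_nonneg herror (by linarith)
  have hδ0 : 0 ≤ δ := by rw [hδ]; positivity
  have ht1 : t ≤ 1 := by
    have i0 : Fin n := ⟨0, by exact_mod_cast hn0⟩
    exact (A.meas i0).le_one_of_le_roundEntropy (N i0) (ht i0)
  set m : ℝ := (1 - π.pErase - π.ε) * n with hm
  have hm0 : 0 < m := mul_pos (by linarith) hn0
  set κ : ℝ := δ / 32 with hκ
  have hκ0 : 0 ≤ κ := by positivity
  -- The length bound forces `δ < t`, and `t ≤ 1`.
  have hκ1 : κ ≤ 1 / 32 := by rw [hκ]; linarith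
  -- The likelihood threshold corresponds to a rate `t - δ` on `m / 2` positions, the smallest
  -- number accepted in one basis.
  set lam : ℝ := 2 ^ (-((t - δ) * m / 2)) with hlam
  have hlam0 : 0 < lam := Real.rpow_pos_of_pos two_pos _
  set γ : ℝ := Real.exp (-(κ / 4) * (Real.log 2 * t - 9 * κ)) with hγ
  have hγ1 : γ ≤ 1 := by
    rw [hγ, Real.exp_le_one_iff]
    have hlog := Real.log_two_gt_d9
    -- Here `9κ = 9δ/32 ≤ 9t/32`, and `9/32 < log 2`.
    have h9 : 0 ≤ Real.log 2 * t - 9 * κ := by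
      have htδ : δ ≤ t := by linarith
      nlinarith [mul_le_mul_of_nonneg_left htδ (Real.log_nonneg one_le_two)]
    nlinarith [mul_nonneg hκ0 h9]
  choose U r V s hJ using fun i k θ =>
    (A.meas i).exists_jointDiagonalization (N i) k θ
  set φ : ∀ i, Fin (A.meas i).outcomes → Bool → ℝ := fun i k θ =>
    (∑ x, overlapMoment κ (r i k θ x) (s i k θ) ((U i k θ x)ᴴ * V i k θ)) / (A.meas i).weight k
    with hφ
  have hφ0 : ∀ i k θ, 0 ≤ φ i k θ := fun i k θ => div_nonneg (Finset.sum_nonneg fun x _ =>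
    PartialMeasurement.overlapMoment_nonneg ((hJ i k θ).nonneg x) (hJ i k θ).nonneg_sum _)
    ((A.meas i).weight_nonneg k)
  have hφγ : ∀ i k, √√(φ i k false) + √√(φ i k true) ≤ 2 * γ := fun i k =>
    PartialMeasurement.sqrt_sqrt_moment_add_le (hJ i k) (ht i) hκ0 hκ1 fun θ => rfl
  -- The opposite label `!D` gets the smaller product, so the string that must look uniform is the
  -- one with the better tail bound.
  set D : (∀ i, Fin (A.meas i).outcomes) → (Bool → Finset (Fin n)) → Bool := fun k I =>
    decide (∏ i ∈ I false, φ i (k i) false ≤ ∏ i ∈ I true, φ i (k i) true) with hD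
  have hDle : ∀ k I, ∏ i ∈ I (!D k I), φ i (k i) (!D k I) ≤ ∏ i ∈ I (D k I), φ i (k i) (D k I) := by
    intro k I
    by_cases hle : ∏ i ∈ I false, φ i (k i) false ≤ ∏ i ∈ I true, φ i (k i) true
    · simp only [hD, decide_eq_true hle, Bool.not_true]
      exact hle
    · simp only [hD, decide_eq_false hle, Bool.not_false]
      exact (not_le.mp hle).le
  obtain ⟨W, hW, hWe⟩ := π.exists_contraction_security N A D
  -- The first summand of `e` bounds the hashing error, the second the spectral tail. In the second
  -- the choice of `D` has disappeared, which leaves a product over the reported set alone.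
  refine hWe _ (π.average_le A (e := fun θ k => π.ε + √(lam ^ (-κ)) *
    ∏ i ∈ A.report k, √√(φ i (k i) (θ i))) (fun θ k hacc => ?_) fun k => ?_)
  · refine (π.sum_hash_trace_le hhash N A θ k _ (fun i => hJ i (k i) (θ i)) hW hlam0 hκ0).trans ?_
    set I := RobustROT.positions θ (A.report k) with hI
    refine mul_le_mul_of_nonneg_left ?_ (mul_nonneg (by positivity)
      (Finset.prod_nonneg fun i _ => (A.meas i).weight_nonneg _))
    rw [mul_add]
    refine add_le_add ?_ (mul_le_mul_of_nonneg_left ?_ zero_le_two)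
    · have := hash_error_le (Nat.cast_nonneg ℓ) hn0.le hε (by linarith)
        (binaryEntropy_le_one pError) (hsyn _ (hacc (!D k I))) hℓ
      rwa [Real.rpow_natCast, Real.rpow_natCast] at this
    · rw [Real.sqrt_mul (by positivity)]
      refine mul_le_mul_of_nonneg_left ?_ (Real.sqrt_nonneg _)
      have hb : ∀ b, ∏ i ∈ I b, φ i (k i) (θ i) = ∏ i ∈ I b, φ i (k i) b := fun b =>
        Finset.prod_congr rfl fun i hi => by rw [(RobustROT.mem_positions.mp hi).2]
      have := sqrt_prod_le_prod_sqrt_sqrt (fun i => hφ0 i (k i) (θ i))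
        (RobustROT.disjoint_positions θ (A.report k) (D k I))
        (by rw [hb, hb]; exact hDle k I)
      rwa [RobustROT.positions_union] at this
  -- The outcomes `k`, hence the reported set, are now fixed while the bases vary. Unless Alice
  -- always aborts, some accepted choice of bases shows that the set has at least `m` elements.
  · by_cases hex : ∃ θ, ∀ b, π.Accepts (RobustROT.positions θ (A.report k) b).card
    · obtain ⟨θ₀, hθ₀⟩ := hex
      have hR : m ≤ (A.report k).card := by
        rw [← RobustROT.positions_union θ₀ (A.report k) true,
          Finset.card_union_of_disjoint (RobustROT.disjoint_positions θ₀ (A.report k) true)]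
        have h1 := (hθ₀ true).1
        have h2 := (hθ₀ (!true)).1
        push_cast
        rw [hm]
        linarith
      have hsum := sum_prod_bool_le (R := A.report k) (a := fun i b => √√(φ i (k i) b))
        (fun i b => Real.sqrt_nonneg _) fun i => hφγ i (k i)
      -- As `γ ≤ 1`, reporting more qubits than necessary only helps Alice.
      have hγm : γ ^ (A.report k).card ≤ γ ^ m := by
        rw [← Real.rpow_natCast]
        exact Real.rpow_le_rpow_of_exponent_ge (Real.exp_pos _) hγ1 hR
      have htail := tail_error_le (t := t) hε hε1 hm0 hδ
      calc _ ≤ ∑ θ : Fin n → Bool, (π.ε + √(lam ^ (-κ)) *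
            ∏ i ∈ A.report k, √√(φ i (k i) (θ i))) := by
            refine Finset.sum_le_sum fun θ _ => ?_
            split_ifs
            · exact le_rfl
            · exact add_nonneg hε.le (mul_nonneg (Real.sqrt_nonneg _)
                (Finset.prod_nonneg fun i _ => Real.sqrt_nonneg _))
        _ = 2 ^ n * π.ε + √(lam ^ (-κ)) *
            ∑ θ : Fin n → Bool, ∏ i ∈ A.report k, √√(φ i (k i) (θ i)) := by
            rw [Finset.sum_add_distrib, ← Finset.mul_sum]
            simp
        _ ≤ 2 ^ n * π.ε + √(lam ^ (-κ)) * (2 ^ n * γ ^ m) := by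
            gcongr
            exact hsum.trans (by gcongr)
        _ = 2 ^ n * (π.ε + √(lam ^ (-κ)) * γ ^ m) := by ring
        _ ≤ 2 ^ n * (2 * π.ε) := by
            gcongr
            linarith
    · rw [Finset.sum_eq_zero fun θ _ => if_neg fun hacc => hex ⟨θ, hacc⟩]
      positivity
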